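/- All graphs are finite and simple. A function $f:V(G)\to\{0,1,2\}$ is an independent Italian dominating function of $G$ if $\sum_{u\in N(v)}f(u)\ge 2$ for every vertex $v$ with $f(v)=0$ and the set $\{v: f(v)\neq 0\}$ is independent; $i_I(G)$ is the minimum of $\sum_{v}f(v)$ over all such $f$. A cut-vertex of a connected graph is a vertex whose deletion disconnects it; a block of $G$ is a maximal connected subgraph without a cut-vertex of its own; $G$ is a block graph if every block is complete. The block-cutpoint graph $T=(V,E)$ of $G$ has as vertices the cut-vertices and the blocks of $G$, a cut-vertex $v$ being adjacent to a block $B$ iff $v\in B$. A block $B$ containing exactly $c$ cut-vertices of $G$ has type $0$, $1$ or $2$ according as $|B|=c$, $|B|=c+1$ or $|B|\ge c+2$. A tree order of $T$ is a listing $v_1,\dots,v_n$ of $V$ such that each $v_i$ with $i<n$ has exactly one neighbour $v_j$ with $j>i$, called its parent. Consider the following algorithm. Its input is $n$ and, for each $i$, the label of $v_i$ (cut-vertex, or block of type $0$, $1$ or $2$) and, for $i<n$, the index of the parent of $v_i$. 1. If $G=K_1$ (that is, $n=1$ and $v_1$ is a block of type $1$), return $1$; if $G=K_r$ with $r\ge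 2$ (that is, $n=1$ otherwise), return $2$. 2. For $i=1,\dots,n$ initialize: if $v_i$ is a cut-vertex, $[c^0,c^1,c^2,c^{00},c^{01}](v_i)\leftarrow[\infty,1,2,0,\infty]$; if $v_i$ is a block of type $0$, $1$, $2$, then $[b^0,b^1,b^2,b^{01},b^{02}](v_i)\leftarrow[0,\infty,\infty,1,2]$, $[\infty,1,\infty,\infty,2]$, $[\infty,\infty,2,\infty,2]$, respectively. 3. For $i=1,\dots,n-1$ let $v_j$ be the parent of $v_i$. All right-hand sides below use the values before the update. If $v_i$ is a cut-vertex, set $$\begin{aligned} b^0(v_j)&\leftarrow b^0(v_j)+c^0(v_i),\\ b^1(v_j)&\leftarrow\min\{b^1(v_j)+c^{01}(v_i)-1,\ b^{01}(v_j)+c^1(v_i)-1\},\\ b^2(v_j)&\leftarrow\min\{b^2(v_j)+c^{00}(v_i),\ b^{02}(v_j)+c^2(v_i)-2\},\\ b^{01}(v_j)&\leftarrow b^{01}(v_j)+c^{01}(v_i)-1,\\ b^{02}(v_j)&\leftarrow b^{02}(v_j)+c^{00}(v_i).\end{aligned}$$ Otherwise set $$\begin{aligned} c^0(v_j)&\leftarrow\min\{c^0(v_j)+b^0(v_i),\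 c^{01}(v_j)+b^1(v_i)-1,\ c^{00}(v_j)+b^2(v_i)\},\\ c^1(v_j)&\leftarrow c^1(v_j)+b^{01}(v_i)-1,\\ c^2(v_j)&\leftarrow c^2(v_j)+b^{02}(v_i)-2,\\ c^{00}(v_j)&\leftarrow c^{00}(v_j)+\min\{b^0(v_i),b^1(v_i),b^2(v_i)\},\\ c^{01}(v_j)&\leftarrow\min\{c^{01}(v_j)+b^0(v_i),\ c^{00}(v_j)+b^1(v_i)+1,\ c^{00}(v_j)+b^2(v_i)+1\}.\end{aligned}$$ 4. If $v_n$ is a cut-vertex, return $\min\{c^0(v_n),c^1(v_n),c^2(v_n)\}$; otherwise return $\min\{b^0(v_n),b^1(v_n),b^2(v_n)\}$. Theorem. There is an absolute constant $C$ such that for every connected block graph $G$ (including complete graphs) with block-cutpoint graph $T=(V,E)$, and every tree order $v_1,\dots,v_n$ of $T$, the algorithm returns $i_I(G)$ after at most $C(n+m)$ steps, where $n=|V|$ and $m=|E|$, on a random access machine on which every addition, subtraction, minimum, comparison, memory access, assignment and loop iteration costs one step. -/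

import Mathlib

namespace ItalianBlock

/-! ### Independent Italian domination -/

/-- `f : V → {0,1,2}` is an Italian dominating function: every vertex of value `0` has
neighbours of total value at least `2`. -/
def IsItalianDominating {V : Type*} [Fintype V] (G : SimpleGraph V) (f : V → ℕ) : Prop :=
  (∀ v, f v ∈ ({0, 1, 2} : Set ℕ)) ∧
    ∀ v, f v = 0 → 2 ≤ open Classical in ∑ u with G.Adj v u, f u

/-- An Italian dominating function whose set `V₁ ∪ V₂` is independent. -/
def IsIndepItalianDominating {V : Type*} [Fintype V] (G : SimpleGraph V) (f : V → ℕ) : Prop :=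
  IsItalianDominating G f ∧ G.IsIndepSet ({v | f v = 1} ∪ {v | f v = 2})

/-- The independent Italian domination number: the minimum weight of an independent Italian
dominating function (a finite graph always has one: the value `2` on a maximal independent set). -/
noncomputable def indepItalianNumber {V : Type*} [Fintype V] (G : SimpleGraph V) : ℕ :=
  sInf {w | ∃ f : V → ℕ, IsIndepItalianDominating G f ∧ w = ∑ v, f v}

/-! ### Blocks, block graphs and the block-cutpoint graph -/

/-- A cut-vertex (of a connected graph): deleting it leaves a disconnected graph with two or more
components. -/
def IsCutVertex {V : Type*} (G : SimpleGraph V) (v : V) : Prop :=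
  ¬ (G.induce {u | u ≠ v}).Preconnected

/-- A block: a maximal connected subgraph without a cut-vertex (of its own). -/
def IsBlock {V : Type*} (G : SimpleGraph V) (B : G.Subgraph) : Prop :=
  Maximal (fun H : G.Subgraph => H.coe.Connected ∧ ∀ v, ¬ IsCutVertex H.coe v) B

/-- A block graph: every block is a complete graph. -/
def IsBlockGraph {V : Type*} (G : SimpleGraph V) : Prop :=
  ∀ B : G.Subgraph, IsBlock G B → B.coe = ⊤

/-- Vertices of the block-cutpoint graph: the cut-vertices and the blocks of `G`. -/
abbrev BCVertex {V : Type*} (G : SimpleGraph V) : Type _ :=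
  {v : V // IsCutVertex G v} ⊕ {B : G.Subgraph // IsBlock G B}

/-- The block-cutpoint graph: a cut-vertex `v` is adjacent to a block `B` iff `v ∈ B`. -/
def blockCutGraph {V : Type*} (G : SimpleGraph V) : SimpleGraph (BCVertex G) where
  Adj
    | .inl v, .inr B => v.1 ∈ B.1.verts
    | .inr B, .inl v => v.1 ∈ B.1.verts
    | .inl _, .inl _ => False
    | .inr _, .inr _ => False
  symm := ⟨by rintro (v | B) (w | D) h <;> exact h⟩
  loopless := ⟨by rintro (v | B) h <;> exact h⟩

/-- The type of a block `B` with set of cut-vertices `C`: `0` if `|B| = |C|`, `1` if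
`|B| = |C| + 1`, and `2` if `|B| ≥ |C| + 2`. -/
noncomputable def blockType {V : Type*} (G : SimpleGraph V) (B : G.Subgraph) : ℕ :=
  if B.verts.ncard = {v ∈ B.verts | IsCutVertex G v}.ncard then 0
  else if B.verts.ncard = {v ∈ B.verts | IsCutVertex G v}.ncard + 1 then 1
  else 2

/-- The label of a vertex of the block-cutpoint graph: the type `0`, `1`, `2` of a block-vertex,
and `3` for a cut-vertex. -/
noncomputable def kindCode {V : Type*} (G : SimpleGraph V) : BCVertex G → ℕ
  | .inl _ => 3
  | .inr B => blockType G B.1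

/-! ### Tree orders -/

/-- `j` is the (position of the) parent of `i` in the order `ord`: a neighbour that comes later. -/
def IsParent {W : Type*} (T : SimpleGraph W) {n : ℕ} (ord : Fin n ≃ W) (i j : Fin n) : Prop :=
  i < j ∧ T.Adj (ord i) (ord j)

/-- `ord` lists the vertices of `T` in a tree order (from the leaves towards the root, which comes
last): every vertex but the last has exactly one neighbour that comes later, its parent. -/
def IsTreeOrder {W : Type*} (T : SimpleGraph W) {n : ℕ} (ord : Fin n ≃ W) : Prop :=
  ∀ i : Fin n, (i : ℕ) + 1 < n → ∃! j, IsParent T ord i j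

/-! ### A unit-cost random access machine with structured programs

Programs use three index registers, two tables of indices, ten arrays of numbers in
`{0, 1, 2, …} ∪ {∞}` and a result register. Every operation, memory access, assignment, test and
loop iteration costs one step. -/

/-- Index registers. -/
inductive Reg
  | size | cur | par
  deriving DecidableEq

/-- Tables of natural numbers. -/
inductive Tab
  | kind | parent
  deriving DecidableEq

/-- Arrays of numbers: the variables `i_c^0, i_c^1, i_c^2, i_c^00, i_c^01` and
`i_b^0, i_b^1, i_b^2, i_b^01, i_b^02`, each of them indexed by the vertices. -/
inductive Arr
  | c0 | c1 | c2 | c00 | c01 | b0 | b1 | b2 | b01 | b02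
  deriving DecidableEq

/-- The memory of the machine. -/
structure Memory where
  reg : Reg → ℕ
  tab : Tab → ℕ → ℕ
  arr : Arr → ℕ → ℕ∞
  result : ℕ∞

/-- Index expressions. -/
inductive IExp
  | lit (k : ℕ)
  | reg (r : Reg)
  | tab (t : Tab) (e : IExp)
  | sub (e₁ e₂ : IExp)

/-- Number expressions. -/
inductive NExp
  | lit (k : ℕ∞)
  | arr (a : Arr) (e : IExp)
  | add (x y : NExp)
  | sub (x y : NExp)
  | min (x y : NExp)

/-- Programs. `loop r lo hi p` runs `p` with `r = lo, lo + 1, …, hi - 1`. -/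
inductive Prog
  | setReg (r : Reg) (e : IExp)
  | setArr (a : Arr) (e : IExp) (x : NExp)
  | ret (x : NExp)
  | seq (p q : Prog)
  | ifEq (e₁ e₂ : IExp) (p q : Prog)
  | loop (r : Reg) (lo hi : IExp) (p : Prog)

/-- Value of an index expression. -/
def IExp.eval (s : Memory) : IExp → ℕ
  | lit k => k
  | reg r => s.reg r
  | tab t e => s.tab t (e.eval s)
  | sub e₁ e₂ => e₁.eval s - e₂.eval s

/-- Number of steps for the evaluation of an index expression. -/
def IExp.cost : IExp → ℕ
  | lit _ => 1
  | reg _ => 1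
  | tab _ e => e.cost + 1
  | sub e₁ e₂ => e₁.cost + e₂.cost + 1

/-- Value of a number expression. -/
noncomputable def NExp.eval (s : Memory) : NExp → ℕ∞
  | lit k => k
  | arr a e => s.arr a (e.eval s)
  | add x y => x.eval s + y.eval s
  | sub x y => x.eval s - y.eval s
  | min x y => x.eval s ⊓ y.eval s

/-- Number of steps for the evaluation of a number expression. -/
def NExp.cost : NExp → ℕ
  | lit _ => 1
  | arr _ e => e.cost + 1
  | add x y => x.cost + y.cost + 1
  | sub x y => x.cost + y.cost + 1
  | min x y => x.cost + y.cost + 1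

/-- Store a value in an index register. -/
def Memory.setReg (s : Memory) (r : Reg) (k : ℕ) : Memory :=
  { s with reg := Function.update s.reg r k }

/-- Store a value in an array cell. -/
def Memory.setArr (s : Memory) (a : Arr) (k : ℕ) (x : ℕ∞) : Memory :=
  { s with arr := Function.update s.arr a (Function.update (s.arr a) k x) }

/-- Execution: the memory after running the program, and the number of steps used. -/
noncomputable def Prog.exec : Prog → Memory → Memory × ℕ
  | setReg r e, s => (s.setReg r (e.eval s), e.cost + 1)
  | setArr a e x, s => (s.setArr a (e.eval s) (x.eval s), e.cost + x.cost + 1)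
  | ret x, s => ({ s with result := x.eval s }, x.cost + 1)
  | seq p q, s =>
    ((q.exec (p.exec s).1).1, (p.exec s).2 + (q.exec (p.exec s).1).2)
  | ifEq e₁ e₂ p q, s =>
    if e₁.eval s = e₂.eval s then
      ((p.exec s).1, e₁.cost + e₂.cost + 1 + (p.exec s).2)
    else
      ((q.exec s).1, e₁.cost + e₂.cost + 1 + (q.exec s).2)
  | loop r lo hi p, s =>
    (List.range' (lo.eval s) (hi.eval s - lo.eval s)).foldl
      (fun st k =>
        ((p.exec (st.1.setReg r k)).1, st.2 + 1 + (p.exec (st.1.setReg r k)).2))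
      (s, lo.cost + hi.cost + 1)

/-! ### The dynamic program -/

infixr:30 " ;; " => Prog.seq
infixl:65 " +' " => NExp.add
infixl:65 " -' " => NExp.sub

/-- The vertex `v_i` that the loop has reached. -/
abbrev vi : IExp := .reg .cur

/-- The parent `v_j` of `v_i`. -/
abbrev vj : IExp := .reg .par

/-- The last vertex `v_n` (position `n - 1`, as positions start at `0`). -/
abbrev vLast : IExp := .sub (.reg .size) (.lit 1)

/-- `[i_c^0, i_c^1, i_c^2, i_c^00, i_c^01](v_i) ← [x₀, x₁, x₂, x₃, x₄]`. -/
def initCut (x₀ x₁ x₂ x₃ x₄ : ℕ∞) : Prog :=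
  .setArr .c0 vi (.lit x₀) ;; .setArr .c1 vi (.lit x₁) ;; .setArr .c2 vi (.lit x₂) ;;
  .setArr .c00 vi (.lit x₃) ;; .setArr .c01 vi (.lit x₄)

/-- `[i_b^0, i_b^1, i_b^2, i_b^01, i_b^02](v_i) ← [x₀, x₁, x₂, x₃, x₄]`. -/
def initBlock (x₀ x₁ x₂ x₃ x₄ : ℕ∞) : Prog :=
  .setArr .b0 vi (.lit x₀) ;; .setArr .b1 vi (.lit x₁) ;; .setArr .b2 vi (.lit x₂) ;;
  .setArr .b01 vi (.lit x₃) ;; .setArr .b02 vi (.lit x₄)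

/-- Initialization of the vertex `v_i`. -/
def initVertex : Prog :=
  .ifEq (.tab .kind vi) (.lit 3) (initCut ⊤ 1 2 0 ⊤) <|
  .ifEq (.tab .kind vi) (.lit 0) (initBlock 0 ⊤ ⊤ 1 2) <|
  .ifEq (.tab .kind vi) (.lit 1) (initBlock ⊤ 1 ⊤ ⊤ 2) <|
    initBlock ⊤ ⊤ 2 ⊤ 2

/-- Update of the parent `v_j`, a block-vertex, of a cut-vertex `v_i`. -/
def updateBlock : Prog :=
  .setArr .b0 vj (.arr .b0 vj +' .arr .c0 vi) ;;
  .setArr .b1 vj (.min (.arr .b1 vj +' .arr .c01 vi -' .lit 1)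
    (.arr .b01 vj +' .arr .c1 vi -' .lit 1)) ;;
  .setArr .b2 vj (.min (.arr .b2 vj +' .arr .c00 vi)
    (.arr .b02 vj +' .arr .c2 vi -' .lit 2)) ;;
  .setArr .b01 vj (.arr .b01 vj +' .arr .c01 vi -' .lit 1) ;;
  .setArr .b02 vj (.arr .b02 vj +' .arr .c00 vi)

/-- Update of the parent `v_j`, a cut-vertex, of a block-vertex `v_i`. The cell `i_c^00(v_j)` is
overwritten last, so that the right-hand sides refer to the old values. -/
def updateCut : Prog :=
  .setArr .c0 vj (.min (.min (.arr .c0 vj +' .arr .b0 vi)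
    (.arr .c01 vj +' .arr .b1 vi -' .lit 1)) (.arr .c00 vj +' .arr .b2 vi)) ;;
  .setArr .c1 vj (.arr .c1 vj +' .arr .b01 vi -' .lit 1) ;;
  .setArr .c2 vj (.arr .c2 vj +' .arr .b02 vi -' .lit 2) ;;
  .setArr .c01 vj (.min (.min (.arr .c01 vj +' .arr .b0 vi)
    (.arr .c00 vj +' .arr .b1 vi +' .lit 1)) (.arr .c00 vj +' .arr .b2 vi +' .lit 1)) ;;
  .setArr .c00 vj (.arr .c00 vj +' .min (.min (.arr .b0 vi) (.arr .b1 vi)) (.arr .b2 vi))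

/-- The whole algorithm. The block-cutpoint graph has a single vertex exactly if `G` is complete,
and that vertex then is a block-vertex of type `1` exactly if `G = K₁`. -/
def algorithm : Prog :=
  .ifEq (.reg .size) (.lit 1)
    (.ifEq (.tab .kind (.lit 0)) (.lit 1) (.ret (.lit 1)) (.ret (.lit 2))) <|
  .loop .cur (.lit 0) (.reg .size) initVertex ;;
  .loop .cur (.lit 0) vLast
    (.setReg .par (.tab .parent vi) ;;
      .ifEq (.tab .kind vi) (.lit 3) updateBlock updateCut) ;;
  .ifEq (.tab .kind vLast) (.lit 3)
    (.ret (.min (.min (.arr .c0 vLast) (.arr .c1 vLast)) (.arr .c2 vLast)))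
    (.ret (.min (.min (.arr .b0 vLast) (.arr .b1 vLast)) (.arr .b2 vLast)))

/-- The memory `s` contains the input of the algorithm, that is, the block-cutpoint graph of `G` in
the tree order `ord`: the number of its vertices, their labels, and their parents. Nothing is
assumed about the rest of the memory. -/
def HoldsInput {V : Type*} (G : SimpleGraph V) {n : ℕ} (ord : Fin n ≃ BCVertex G)
    (s : Memory) : Prop :=
  s.reg .size = n ∧
  (∀ i : Fin n, s.tab .kind i = kindCode G (ord i)) ∧
  (∀ i j : Fin n, IsParent (blockCutGraph G) ord i j → s.tab .parent i = j)

end ItalianBlock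

/-! Blocks are cliques, so an independent Italian dominating function $f$ is nonzero on at most one
vertex of each block. Up to the choice of a private (non-cut) vertex, $f$ is therefore recorded by
labels on the block-cutpoint tree: a cut-vertex carries $f(v)$; a block carries its total $F$ and
the share $s$ of $F$ on private vertices. Two blocks share at most one vertex, so a vertex of value
$0$ receives the sum of the totals of its blocks, and domination and independence become local
conditions on labels. One kind of $f$ is not covered by the initial tables: value $2$ on the only
private vertex of a block. `exists_lower_of_simplicial` removes such values without raising the
weight. Hence the least cost of consistent labels is $i_I(G)$ (`minCost_eq_indepItalianNumber`).

The arrays are cost tables of a partially eliminated tree. The entries $c^{00}$, $c^{01}-1$, $c^0$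
price a cut-vertex of value $0$ that is guaranteed at least $0$, $1$, $2$ by eliminated blocks. The
entries $b^{01}$, $b^{02}$ already include the $1$ or $2$ to be placed on a cut-vertex not yet
eliminated, which explains the subtractions. An update minimizes over the label of a leaf and stores
the result at its parent (`blockStep`, `cutStep`), so the least cost of the remaining labels does
not change (`minCost_succ`). When only the root is left, that minimum is the returned value.

Subtraction in `ℕ∞` is truncated, so `TableBounds` is carried along; its bounds on $c^{00}$,
$c^{01}$, $c^0$ also say that a stronger guarantee is never cheaper. Each of the fewer than $2n$
iterations takes a bounded number of steps. -/

namespace ItalianBlock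

/-! ### Blocks of a block graph -/

variable {V : Type*} {G : SimpleGraph V}

/-- The target is the graph that occurs in `IsCutVertex` for an induced subgraph, so walks found in
`G` can be used to refute cut-vertices there. -/
lemma reachable_coe_induce_of_walk {S : Set V} {x : S} {a b : V} (p : G.Walk a b)
    (h : ∀ z ∈ p.support, z ∈ S ∧ z ≠ x) :
    ((((⊤ : G.Subgraph).induce S).coe).induce {u | u ≠ x}).Reachable
      ⟨⟨a, (h a p.start_mem_support).1⟩,
        fun e => (h a p.start_mem_support).2 (congrArg Subtype.val e)⟩
      ⟨⟨b, (h b p.end_mem_support).1⟩,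
        fun e => (h b p.end_mem_support).2 (congrArg Subtype.val e)⟩ := by
  induction p with
  | nil => exact SimpleGraph.Reachable.rfl
  | @cons a c b hac p ih =>
    have h' : ∀ z ∈ p.support, z ∈ S ∧ z ≠ x := fun z hz => h z (by simp [hz])
    refine SimpleGraph.Reachable.trans ?_ (ih h')
    apply SimpleGraph.Adj.reachable
    have h1 := (h a (by simp)).1
    have h2 := (h' c (by simp)).1
    exact ⟨h1, h2, hac⟩

lemma exists_isBlock_ge [Finite V] (H : G.Subgraph) (hc : H.coe.Connected)
    (hH : ∀ v, ¬ IsCutVertex H.coe v) : ∃ B, IsBlock G B ∧ H ≤ B := by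
  obtain ⟨B, h1, h2⟩ := Finite.exists_le_maximal
    (p := fun H : G.Subgraph => H.coe.Connected ∧ ∀ v, ¬ IsCutVertex H.coe v) ⟨hc, hH⟩
  exact ⟨B, h2, h1⟩

lemma exists_isBlock_mem [Finite V] (v : V) : ∃ B, IsBlock G B ∧ v ∈ B.verts := by
  obtain ⟨B, hB, hle⟩ := exists_isBlock_ge (G.singletonSubgraph v)
    SimpleGraph.Subgraph.singletonSubgraph_connected.coe (by
      rintro ⟨w, hw⟩ h
      refine h fun a => ?_
      obtain ⟨⟨a, ha⟩, hne⟩ := a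
      have ha' : a = v := ha
      have hw' : w = v := hw
      exact absurd (Subtype.ext (ha'.trans hw'.symm)) hne)
  exact ⟨B, hB, hle.1 (by simp)⟩

lemma exists_isBlock_of_adj [Finite V] {u v : V} (h : G.Adj u v) :
    ∃ B, IsBlock G B ∧ u ∈ B.verts ∧ v ∈ B.verts := by
  obtain ⟨B, hB, hle⟩ := exists_isBlock_ge (G.subgraphOfAdj h)
    (SimpleGraph.Subgraph.subgraphOfAdj_connected h).coe (by
      rintro ⟨w, hw⟩ hcut
      refine hcut fun a b => ?_
      have : a = b := by
        obtain ⟨⟨a, ha⟩, hna⟩ := a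
        obtain ⟨⟨b, hb⟩, hnb⟩ := b
        have h1 : a ≠ w := fun e => hna (Subtype.ext e)
        have h2 : b ≠ w := fun e => hnb (Subtype.ext e)
        simp only [SimpleGraph.subgraphOfAdj_verts, Set.mem_insert_iff,
          Set.mem_singleton_iff] at ha hb hw
        have : a = b := by grind
        subst this; rfl
      rw [this])
  exact ⟨B, hB, hle.1 (by simp), hle.1 (by simp)⟩

lemma IsBlock.adj {B : G.Subgraph} (hG : IsBlockGraph G) (hB : IsBlock G B) {u v : V}
    (hu : u ∈ B.verts) (hv : v ∈ B.verts) (h : u ≠ v) : G.Adj u v := by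
  have : B.coe.Adj ⟨u, hu⟩ ⟨v, hv⟩ := by
    rw [hG B hB]; simpa using h
  exact B.adj_sub this

/-- Completeness of `D` turns the inclusion of vertex sets into an inclusion of subgraphs;
maximality of `B` does the rest. -/
lemma IsBlock.eq_of_verts_subset {B D : G.Subgraph} (hG : IsBlockGraph G) (hB : IsBlock G B)
    (hD : IsBlock G D) (h : B.verts ⊆ D.verts) : B = D := by
  refine le_antisymm ?_ (hB.2 hD.1 ?_)
  all_goals
  refine ⟨h, fun u v huv => ?_⟩
  have : D.coe.Adj ⟨u, h (B.edge_vert huv)⟩ ⟨v, h (B.edge_vert huv.symm)⟩ := by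
    rw [hG D hD]
    simpa using huv.ne
  exact this

/-- A vertex that is not a cut-vertex lies in only one block. -/
lemma IsBlock.eq_of_mem {B D : G.Subgraph} (hG : IsBlockGraph G) (hB : IsBlock G B)
    (hD : IsBlock G D) {v : V} (hv : ¬ IsCutVertex G v) (hvB : v ∈ B.verts)
    (hvD : v ∈ D.verts) : B = D := by
  by_cases hBv : B.verts ⊆ {v}
  · exact hB.eq_of_verts_subset hG hD fun u hu => by rw [hBv hu]; exact hvD
  by_cases hDv : D.verts ⊆ {v}
  · exact (hD.eq_of_verts_subset hG hB fun u hu => by rw [hDv hu]; exact hvB).symm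
  obtain ⟨a, haB, hav⟩ := Set.not_subset.1 hBv
  obtain ⟨b, hbD, hbv⟩ := Set.not_subset.1 hDv
  obtain ⟨p, hp⟩ : ∃ p : G.Walk a b, p.IsPath ∧ v ∉ p.support := by
    classical
    obtain ⟨q⟩ := not_not.1 hv ⟨a, hav⟩ ⟨b, hbv⟩
    let q' : G.Walk a b := q.map (SimpleGraph.Embedding.induce _).toHom
    have hq' : v ∉ q'.support := by
      intro h
      obtain ⟨⟨y, hy⟩, -, e⟩ := List.mem_map.1 ((SimpleGraph.Walk.support_map _ q) ▸ h)
      exact hy e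
    exact ⟨q'.bypass, q'.bypass_isPath, fun h => hq' (q'.support_bypass_subset_support h)⟩
  obtain ⟨hp, hvp⟩ := hp
  -- The two blocks together with a path that joins them outside `v` induce a connected subgraph
  -- without a cut-vertex; by maximality both blocks equal it.
  set S : Set V := B.verts ∪ D.verts ∪ {z | z ∈ p.support} with hS
  have hvS : v ∈ S := by simp [hS, hvB]
  have hpS : ∀ z ∈ p.support, z ∈ S := fun z hz => Or.inr hz
  have haS : a ∈ S := by simp [hS, haB]
  have hbS : b ∈ S := by simp [hS, hbD]
  -- If `x ≠ v` is deleted, every `z` still reaches `v`: a vertex of a block directly, a vertex of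
  -- the path through that end of the path which `x` does not separate from it.
  have key : ∀ (x z : V), x ≠ z → z ∈ S → x ≠ v → ∃ w : G.Walk z v, ∀ y ∈ w.support,
      y ∈ S ∧ y ≠ x := by
    intro x z hxz hz hxv
    by_cases hzv : z = v
    · subst hzv; exact ⟨.nil, by simpa using ⟨hz, hxz.symm⟩⟩
    rcases hz with (hz | hz) | hz
    · refine ⟨.cons (hB.adj hG hz hvB hzv) .nil, ?_⟩
      simp [hS, hz, hvB, hxz.symm, hxv.symm]
    · refine ⟨.cons (hD.adj hG hz hvD hzv) .nil, ?_⟩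
      simp [hS, hz, hvB, hxz.symm, hxv.symm]
    · classical
      have hz' : z ∈ p.support := hz
      have hdisj : x ∉ (p.takeUntil z hz').support ∨ x ∉ (p.dropUntil z hz').support := by
        by_contra! hcon
        have hn := hp.support_nodup
        rw [← p.take_spec hz', SimpleGraph.Walk.support_append, List.nodup_append] at hn
        have h2 := hcon.2
        rw [← SimpleGraph.Walk.cons_tail_support, List.mem_cons] at h2
        rcases h2 with h2 | h2
        · exact hxz h2
        · exact hn.2.2 x hcon.1 x h2 rfl
      rcases hdisj with h | h
      · refine ⟨(p.takeUntil z hz').reverse.concat (hB.adj hG haB hvB hav), ?_⟩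
        intro y hy
        simp only [SimpleGraph.Walk.support_concat, SimpleGraph.Walk.support_reverse,
          List.mem_append, List.mem_reverse, List.mem_singleton] at hy
        rcases hy with hy | rfl
        · exact ⟨hpS y (p.support_takeUntil_subset_support hz' hy), fun e => h (e ▸ hy)⟩
        · exact ⟨hvS, hxv.symm⟩
      · refine ⟨(p.dropUntil z hz').concat (hD.adj hG hbD hvD hbv), ?_⟩
        intro y hy
        simp only [SimpleGraph.Walk.support_concat,
          List.mem_append, List.mem_singleton] at hy
        rcases hy with hy | rfl
        · exact ⟨hpS y (p.support_dropUntil_subset_support hz' hy), fun e => h (e ▸ hy)⟩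
        · exact ⟨hvS, hxv.symm⟩
  -- If `v` itself is deleted, the path `p` keeps the two blocks together.
  have key' : ∀ z, v ≠ z → z ∈ S → ∃ w : G.Walk z a, ∀ y ∈ w.support, y ∈ S ∧ y ≠ v := by
    intro z hvz hz
    classical
    have hap : ∀ y ∈ p.support, y ∈ S ∧ y ≠ v := fun y hy => ⟨hpS y hy, fun e => hvp (e ▸ hy)⟩
    rcases hz with (hz | hz) | hz
    · by_cases hza : z = a
      · subst hza; exact ⟨.nil, by simpa using ⟨haS, hvz.symm⟩⟩
      · refine ⟨.cons (hB.adj hG hz haB hza) .nil, ?_⟩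
        have : a ≠ v := hav
        simp [hS, hz, haB, hvz.symm, this]
    · by_cases hzb : z = b
      · subst hzb; exact ⟨p.reverse, by simpa using hap⟩
      · refine ⟨.cons (hD.adj hG hz hbD hzb) p.reverse, ?_⟩
        intro y hy
        simp only [SimpleGraph.Walk.support_cons, SimpleGraph.Walk.support_reverse,
          List.mem_cons, List.mem_reverse] at hy
        rcases hy with rfl | hy
        · exact ⟨by simp [hS, hz], hvz.symm⟩
        · exact hap y hy
    · have hz' : z ∈ p.support := hz
      refine ⟨(p.takeUntil z hz').reverse, fun y hy => hap y ?_⟩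
      exact p.support_takeUntil_subset_support hz' (by simpa using hy)
  have hH : (((⊤ : G.Subgraph).induce S).coe).Connected ∧
      ∀ x, ¬ IsCutVertex ((⊤ : G.Subgraph).induce S).coe x := by
    constructor
    · rw [← SimpleGraph.induce_eq_coe_induce_top]
      have : Nonempty S := ⟨⟨v, hvS⟩⟩
      have hadj : ∀ z (hz : z ∈ S), (G.induce S).Reachable ⟨z, hz⟩ ⟨v, hvS⟩ := by
        intro z hz
        by_cases hzv : z = v
        · subst hzv; rfl
        obtain ⟨w, hw⟩ := key' z (Ne.symm hzv) hz
        exact ((w.induce S fun y hy => (hw y hy).1).reachable).trans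
          (SimpleGraph.Adj.reachable (by simpa using hB.adj hG haB hvB hav))
      refine { preconnected := fun z y => (hadj z.1 z.2).trans (hadj y.1 y.2).symm, nonempty := this }
    · rintro ⟨x, hx⟩ hcut
      refine hcut ?_
      by_cases hxv : x = v
      · subst hxv
        rintro ⟨⟨y, hy⟩, hyx⟩ ⟨⟨z, hz⟩, hzx⟩
        obtain ⟨w1, h1⟩ := key' y (fun e => hyx (Subtype.ext e.symm)) hy
        obtain ⟨w2, h2⟩ := key' z (fun e => hzx (Subtype.ext e.symm)) hz
        exact (reachable_coe_induce_of_walk (x := ⟨x, hx⟩) w1 h1).trans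
          (reachable_coe_induce_of_walk (x := ⟨x, hx⟩) w2 h2).symm
      · rintro ⟨⟨y, hy⟩, hyx⟩ ⟨⟨z, hz⟩, hzx⟩
        obtain ⟨w1, h1⟩ := key x y (fun e => hyx (Subtype.ext e.symm)) hy hxv
        obtain ⟨w2, h2⟩ := key x z (fun e => hzx (Subtype.ext e.symm)) hz hxv
        exact (reachable_coe_induce_of_walk (x := ⟨x, hx⟩) w1 h1).trans
          (reachable_coe_induce_of_walk (x := ⟨x, hx⟩) w2 h2).symm
  have hle : ∀ E : G.Subgraph, E.verts ⊆ S → E ≤ (⊤ : G.Subgraph).induce S := by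
    intro E hE
    refine ⟨hE, fun y z hyz => ?_⟩
    exact ⟨hE (E.edge_vert hyz), hE (E.edge_vert hyz.symm), by simpa using E.adj_sub hyz⟩
  have hB' := hle B fun z hz => Or.inl (Or.inl hz)
  have hD' := hle D fun z hz => Or.inl (Or.inr hz)
  rw [le_antisymm hB' (hB.2 hH hB')]
  exact (le_antisymm hD' (hD.2 hH hD')).symm

/-! ### Eliminating a leaf from a labelled tree -/

section Elimination

variable {n : ℕ} {A : Fin n → Fin n → Prop} {cut : Fin n → Prop} {κ κ' : Fin n → ℕ → ℕ → ℕ∞}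

open Classical in
/-- The total label of the neighbours of `i` among the positions `≥ t`. -/
noncomputable def restSum (A : Fin n → Fin n → Prop) (t : ℕ) (p : Fin n → ℕ) (i : Fin n) : ℕ :=
  ∑ k ∈ Finset.univ.filter (fun k : Fin n => t ≤ k.val ∧ A i k), p k

/-- Consistent labels of the positions `≥ t`. A cut-vertex carries its value `p` and a lower bound
`q` on what it receives from the eliminated blocks; a block carries its total value `p` and the
part `q` of it on private vertices and on eliminated cut-vertices. -/
def Consistent (A : Fin n → Fin n → Prop) (cut : Fin n → Prop) (t : ℕ) (p q : Fin n → ℕ) : Prop :=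
  ∀ i : Fin n, t ≤ i →
    (cut i → p i = 0 → 2 ≤ q i + restSum A t p i) ∧
    (¬ cut i → p i = q i + restSum A t p i ∧
      ∀ k : Fin n, t ≤ k → A i k → p k = 0 ∨ p k = p i)

/-- The total cost of the labels of the positions `≥ t`. -/
noncomputable def totalCost (κ : Fin n → ℕ → ℕ → ℕ∞) (t : ℕ) (p q : Fin n → ℕ) : ℕ∞ :=
  ∑ i ∈ Finset.univ.filter (fun i : Fin n => t ≤ i.val), κ i (p i) (q i)

/-- The least total cost of consistent labels of the positions `≥ t`. -/
noncomputable def minCost (A : Fin n → Fin n → Prop) (cut : Fin n → Prop)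
    (κ : Fin n → ℕ → ℕ → ℕ∞) (t : ℕ) : ℕ∞ :=
  ⨅ (p : Fin n → ℕ) (q : Fin n → ℕ) (_ : Consistent A cut t p q), totalCost κ t p q

/-- Labels of infinite cost never matter, so the backward conditions of `CutStep` and `BlockStep`
are needed for finite entries only. -/
lemma minCost_le_minCost {t u : ℕ}
    (h : ∀ p q, Consistent A cut t p q → totalCost κ t p q ≠ ⊤ →
      ∃ p' q', Consistent A cut u p' q' ∧ totalCost κ' u p' q' ≤ totalCost κ t p q) :
    minCost A cut κ' u ≤ minCost A cut κ t := by
  refine le_iInf fun p => le_iInf fun q => le_iInf fun hc => ?_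
  by_cases htop : totalCost κ t p q = ⊤
  · rw [htop]; exact le_top
  obtain ⟨p', q', hc', hle⟩ := h p q hc htop
  exact le_trans (iInf_le_of_le p' (iInf_le_of_le q' (iInf_le _ hc'))) hle

lemma restSum_eq_add (t : Fin n) (p : Fin n → ℕ) {i : Fin n} (h : A i t) :
    restSum A t p i = p t + restSum A (t + 1) p i := by
  classical
  unfold restSum
  rw [← Finset.sum_insert (s := Finset.univ.filter fun k : Fin n => (t : ℕ) + 1 ≤ k ∧ A i k)
    (by simp)]
  congr 1
  ext k
  simp only [Finset.mem_filter, Finset.mem_univ, true_and, Finset.mem_insert]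
  constructor
  · rintro ⟨h1, h2⟩
    rcases eq_or_ne k t with h3 | h3
    · exact .inl h3
    · exact .inr ⟨by have := Fin.val_ne_of_ne h3; omega, h2⟩
  · rintro (rfl | ⟨h1, h2⟩)
    · exact ⟨le_rfl, h⟩
    · exact ⟨by omega, h2⟩

lemma restSum_eq_of_not (t : Fin n) (p : Fin n → ℕ) {i : Fin n} (h : ¬ A i t) :
    restSum A t p i = restSum A (t + 1) p i := by
  classical
  unfold restSum
  congr 1
  ext k
  simp only [Finset.mem_filter, Finset.mem_univ, true_and]
  constructor
  · rintro ⟨h1, h2⟩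
    rcases eq_or_ne k t with h3 | h3
    · subst h3; exact absurd h2 h
    · exact ⟨by have := Fin.val_ne_of_ne h3; omega, h2⟩
  · rintro ⟨h1, h2⟩
    exact ⟨by omega, h2⟩

lemma restSum_congr {t : ℕ} {p p' : Fin n → ℕ} {i : Fin n}
    (h : ∀ k : Fin n, t ≤ k → A i k → p k = p' k) : restSum A t p i = restSum A t p' i := by
  classical
  refine Finset.sum_congr rfl fun k hk => ?_
  simp only [Finset.mem_filter, Finset.mem_univ, true_and] at hk
  exact h k hk.1 hk.2

lemma restSum_parent {t j : Fin n} (htj : t < j) (hA : A t j)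
    (huniq : ∀ k, t < k → A t k → k = j) (p : Fin n → ℕ) :
    restSum A (t + 1) p t = p j := by
  classical
  unfold restSum
  rw [show (Finset.univ.filter fun k : Fin n => (t : ℕ) + 1 ≤ k ∧ A t k) = {j} from ?_]
  · simp
  · ext k
    simp only [Finset.mem_filter, Finset.mem_univ, true_and, Finset.mem_singleton]
    exact ⟨fun h => huniq k h.1 h.2, fun h => h ▸ ⟨htj, hA⟩⟩

lemma totalCost_eq_add (t : Fin n) (p q : Fin n → ℕ) :
    totalCost κ t p q = κ t (p t) (q t) + totalCost κ (t + 1) p q := by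
  classical
  unfold totalCost
  rw [← Finset.sum_insert (s := Finset.univ.filter fun k : Fin n => (t : ℕ) + 1 ≤ k)
    (f := fun i => κ i (p i) (q i)) (by simp)]
  congr 1
  ext k
  simp only [Finset.mem_filter, Finset.mem_univ, true_and, Finset.mem_insert]
  constructor
  · intro h1
    rcases eq_or_ne k t with h3 | h3
    · exact .inl h3
    · exact .inr (by have := Fin.val_ne_of_ne h3; omega)
  · rintro (rfl | h1)
    · exact le_rfl
    · omega

/-- One remainder `R` serves all data that agree away from `j`, which reduces a comparison of total
costs to the single entry at `j`. -/
lemma exists_totalCost_eq_add {t : ℕ} {j : Fin n} (htj : t ≤ j) (κ : Fin n → ℕ → ℕ → ℕ∞)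
    (p q : Fin n → ℕ) :
    ∃ R, ∀ (κ' : Fin n → ℕ → ℕ → ℕ∞) (p' q' : Fin n → ℕ),
      (∀ i : Fin n, t ≤ i → i ≠ j → κ' i = κ i ∧ p' i = p i ∧ q' i = q i) →
      totalCost κ' t p' q' = κ' j (p' j) (q' j) + R := by
  classical
  refine ⟨∑ i ∈ (Finset.univ.filter fun i : Fin n => t ≤ (i : ℕ)).erase j, κ i (p i) (q i), ?_⟩
  intro κ' p' q' h
  unfold totalCost
  rw [← Finset.add_sum_erase _ _ (show j ∈ Finset.univ.filter fun i : Fin n => t ≤ (i : ℕ) by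
    simpa using htj)]
  congr 1
  refine Finset.sum_congr rfl fun i hi => ?_
  simp only [Finset.mem_erase, Finset.mem_filter, Finset.mem_univ, true_and] at hi
  obtain ⟨h1, h2, h3⟩ := h i hi.2 hi.1
  rw [h1, h2, h3]

/-- Cost tables of a cut-vertex before (`f`) and after (`f'`) the elimination of a child block with
cost table `g`. -/
structure CutStep (f g f' : ℕ → ℕ → ℕ∞) : Prop where
  forward : ∀ x a s, (x = 0 ∨ s = 0) → f' x (a + (s + x)) ≤ f x a + g (s + x) s
  backward : ∀ x a', f' x a' ≠ ⊤ → ∃ a s, (x = 0 ∨ s = 0) ∧ (x = 0 → min 2 a' ≤ a + s) ∧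
    f x a + g (s + x) s ≤ f' x a'

/-- Cost tables of a block before (`f`) and after (`f'`) the elimination of a child cut-vertex with
cost table `g`. -/
structure BlockStep (f g f' : ℕ → ℕ → ℕ∞) : Prop where
  forward : ∀ F s x a, s + x ≤ F → (x = 0 → 2 ≤ a + F) → (x = 0 ∨ x = F) → f' F (s + x) ≤ f F s + g x a
  backward : ∀ F s', f' F s' ≠ ⊤ → ∃ s x a, s' = s + x ∧ (x = 0 → 2 ≤ a + F) ∧ (x = 0 ∨ x = F) ∧
    f F s + g x a ≤ f' F s'

lemma ne_top_of_totalCost_ne_top {t : ℕ} {p q : Fin n → ℕ} (h : totalCost κ t p q ≠ ⊤)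
    {i : Fin n} (hi : t ≤ i) : κ i (p i) (q i) ≠ ⊤ := by
  intro he
  apply h
  obtain ⟨R, hR⟩ := exists_totalCost_eq_add hi κ p q
  rw [hR κ p q (by simp), he, top_add]

variable {t j : Fin n}

/-- Among the positions `≥ t`, the only neighbour of `t` is `j`, so the label of `t` interacts with
that of `j` alone. The forward condition of a step prices the removal of `t`, the backward condition
supplies a label with which to reinsert it. -/
lemma minCost_succ (hsymm : ∀ i k, A i k → A k i)
    (hbip : ∀ i k, A i k → (cut i ↔ ¬ cut k)) (htj : t < j) (hA : A t j)
    (huniq : ∀ k, t < k → A t k → k = j)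
    (hκ : ∀ i, i ≠ j → κ' i = κ i)
    (hcut : cut j → CutStep (κ j) (κ t) (κ' j))
    (hblock : ¬ cut j → BlockStep (κ j) (κ t) (κ' j)) :
    minCost A cut κ' (t + 1) = minCost A cut κ t := by
  have hAjt := hsymm _ _ hA
  have hself : ∀ i, ¬ A i i := fun i h => by have := hbip _ _ h; tauto
  have hother : ∀ i : Fin n, (t : ℕ) + 1 ≤ i → i ≠ j → ¬ A i t := fun i hi hij h =>
    hij (huniq i hi (hsymm _ _ h))
  have htj' : (t : ℕ) + 1 ≤ j := htj
  apply le_antisymm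
  · refine minCost_le_minCost fun p q hc _ => ?_
    -- One formula serves both kinds: a cut-vertex `j` receives the total `p t` of the eliminated
    -- block, and a block `j` takes the value `p t` of the eliminated cut-vertex into its share.
    set q' := Function.update q j (q j + p t) with hq'
    have hq'j : q' j = q j + p t := by simp [hq']
    have hq'i : ∀ i, i ≠ j → q' i = q i := fun i hi => by simp [hq', hi]
    refine ⟨p, q', ?_, ?_⟩
    · intro i hi
      obtain ⟨h1, h2⟩ := hc i (by omega)
      rcases eq_or_ne i j with rfl | hij
      · rw [restSum_eq_add t p hAjt, ← add_assoc] at h1 h2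
        rw [hq'j]
        exact ⟨h1, fun h => ⟨(h2 h).1, fun k hk => (h2 h).2 k (by omega)⟩⟩
      · rw [restSum_eq_of_not t p (hother i hi hij)] at h1 h2
        rw [hq'i i hij]
        exact ⟨h1, fun h => ⟨(h2 h).1, fun k hk => (h2 h).2 k (by omega)⟩⟩
    · obtain ⟨R, hR⟩ := exists_totalCost_eq_add htj' κ p q
      rw [totalCost_eq_add t, hR κ' p q' fun i _ hi => ⟨hκ i hi, rfl, hq'i i hi⟩,
        hR κ p q (by simp), ← add_assoc, add_comm (κ t _ _), hq'j]
      gcongr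
      obtain ⟨ht1, ht2⟩ := hc t le_rfl
      rw [restSum_eq_of_not t p (hself t), restSum_parent htj hA huniq] at ht1 ht2
      by_cases hcj : cut j
      · have hct : ¬ cut t := by have := hbip _ _ hA; tauto
        obtain ⟨h1, h2⟩ := ht2 hct
        have h3 := h2 j (by omega) hA
        have := (hcut hcj).forward (p j) (q j) (q t) (by omega)
        rwa [← h1] at this
      · have hct : cut t := by have := hbip _ _ hA; tauto
        obtain ⟨h3, h4⟩ := (hc j (by omega)).2 hcj
        rw [restSum_eq_add t p hAjt] at h3
        exact (hblock hcj).forward _ _ _ _ (by omega) (ht1 hct) (h4 t le_rfl hAjt)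
  · refine minCost_le_minCost fun p q hc htop => ?_
    have hne := ne_top_of_totalCost_ne_top htop htj'
    -- The pair `(x, b)` is the label for `t`, and `a` replaces `q j`. For a cut-vertex `j` only
    -- `min 2 (q j)` is recovered, which is enough because domination asks for no more than `2`.
    obtain ⟨a, x, b, hjc, hjb, hle⟩ : ∃ a x b,
        (cut j → (p j = 0 ∨ b = 0) ∧ x = b + p j ∧ (p j = 0 → min 2 (q j) ≤ a + x)) ∧
        (¬ cut j → q j = a + x ∧ (x = 0 → 2 ≤ b + p j) ∧ (x = 0 ∨ x = p j)) ∧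
        κ j (p j) a + κ t x b ≤ κ' j (p j) (q j) := by
      by_cases hcj : cut j
      · obtain ⟨a, s, h1, h2, h3⟩ := (hcut hcj).backward _ _ hne
        exact ⟨a, s + p j, s, fun _ => ⟨h1, rfl, fun h => by have := h2 h; omega⟩,
          fun h => absurd hcj h, h3⟩
      · obtain ⟨s, x, a, h1, h2, h3, h4⟩ := (hblock hcj).backward _ _ hne
        exact ⟨s, x, a, fun h => absurd h hcj, fun _ => ⟨h1, h2, h3⟩, h4⟩
    set p' := Function.update p t x with hp'
    set q' := Function.update (Function.update q j a) t b with hq'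
    have hp't : p' t = x := by simp [hp']
    have hp'i : ∀ i, i ≠ t → p' i = p i := fun i hi => by simp [hp', hi]
    have hq't : q' t = b := by simp [hq']
    have hq'j : q' j = a := by simp [hq', htj.ne']
    have hq'i : ∀ i, i ≠ t → i ≠ j → q' i = q i := fun i hi hj => by simp [hq', hi, hj]
    have hgt : ∀ i : Fin n, (t : ℕ) + 1 ≤ i → i ≠ t := fun i hi h => by subst h; omega
    have hrest : ∀ i, restSum A (t + 1) p' i = restSum A (t + 1) p i := fun i =>
      restSum_congr fun k hk _ => hp'i k (hgt k hk)
    have hpj := hp'i j htj.ne'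
    refine ⟨p', q', ?_, ?_⟩
    · intro i hi
      rcases eq_or_ne i t with rfl | hit
      · rw [restSum_eq_of_not i p' (hself i), restSum_parent htj hA huniq, hpj, hp't, hq't]
        refine ⟨fun h h0 => (hjb ?_).2.1 h0, fun h => ⟨(hjc ?_).2.1, ?_⟩⟩
        · have := hbip _ _ hA; tauto
        · have := hbip _ _ hA; tauto
        · intro k hk hik
          have hcj : cut j := by have := hbip _ _ hA; tauto
          have hkj : k = j := by
            refine huniq k (lt_of_le_of_ne hk ?_) hik
            rintro rfl
            exact hself _ hik
          subst hkj
          rw [hpj]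
          have := hjc hcj
          omega
      · have hi' : (t : ℕ) + 1 ≤ i := by have := Fin.val_ne_of_ne hit; omega
        obtain ⟨h1, h2⟩ := hc i hi'
        rcases eq_or_ne i j with rfl | hij
        · rw [restSum_eq_add t p' hAjt, hrest, hpj, hp't, hq'j]
          refine ⟨fun h h0 => ?_, fun h => ⟨?_, ?_⟩⟩
          · have := h1 h h0
            have := (hjc h).2.2 h0
            omega
          · have := (h2 h).1
            have := (hjb h).1
            omega
          · intro k hk hik
            rcases eq_or_ne k t with rfl | hkt
            · rw [hp't]; exact (hjb h).2.2
            · rw [hp'i k hkt]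
              exact (h2 h).2 k (by have := Fin.val_ne_of_ne hkt; omega) hik
        · rw [restSum_eq_of_not t p' (hother i hi' hij), hrest, hp'i i hit, hq'i i hit hij]
          refine ⟨h1, fun h => ⟨(h2 h).1, fun k hk hik => ?_⟩⟩
          have hkt : k ≠ t := by rintro rfl; exact hother i hi' hij hik
          rw [hp'i k hkt]
          exact (h2 h).2 k (by have := Fin.val_ne_of_ne hkt; omega) hik
    · obtain ⟨R, hR⟩ := exists_totalCost_eq_add htj' κ' p q
      rw [totalCost_eq_add t, hp't, hq't,
        hR κ p' q' fun i hi hij => ⟨(hκ i hij).symm, hp'i i (hgt i hi), hq'i i (hgt i hi) hij⟩,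
        hR κ' p q (by simp), ← add_assoc, add_comm (κ t _ _), hq'j, hpj]
      gcongr

end Elimination

/-! ### The cost tables and their updates -/

/-- The cost of a label `(x, a)` of a cut-vertex. -/
noncomputable def cutCost (c0 c1 c2 c00 c01 : ℕ∞) : ℕ → ℕ → ℕ∞
  | 0, 0 => c00
  | 0, 1 => c01 - 1
  | 0, _ + 2 => c0
  | 1, _ => c1
  | 2, _ => c2
  | _ + 3, _ => ⊤

/-- The cost of a label `(F, s)` of a block. -/
noncomputable def blockCost (b0 b1 b2 b01 b02 : ℕ∞) : ℕ → ℕ → ℕ∞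
  | 0, 0 => b0
  | 1, 1 => b1
  | 2, 2 => b2
  | 1, 0 => b01 - 1
  | 2, 0 => b02 - 2
  | _, _ => ⊤

lemma blockCost_eq_top {b0 b1 b2 b01 b02 : ℕ∞} {F s : ℕ} (h : 3 ≤ F ∨ (s ≠ 0 ∧ s ≠ F)) :
    blockCost b0 b1 b2 b01 b02 F s = ⊤ := by
  unfold blockCost
  split <;> first | rfl | omega

lemma cutCost_eq_top {c0 c1 c2 c00 c01 : ℕ∞} {x a : ℕ} (h : 3 ≤ x) :
    cutCost c0 c1 c2 c00 c01 x a = ⊤ := by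
  unfold cutCost
  split <;> first | rfl | omega

lemma cutCost_zero_of_two_le {c0 c1 c2 c00 c01 : ℕ∞} {a : ℕ} (h : 2 ≤ a) :
    cutCost c0 c1 c2 c00 c01 0 a = c0 := by
  obtain ⟨a, rfl⟩ := Nat.exists_eq_add_of_le' h
  rfl

lemma add_add_one_sub_one (a b : ℕ∞) : a + (b + 1) - 1 = a + b := by
  rw [← add_assoc]; exact (ENat.addLECancellable_of_ne_top (by simp)).add_tsub_cancel_right

lemma add_one_add_sub_one (a b : ℕ∞) : a + 1 + b - 1 = a + b := by
  rw [add_right_comm]; exact (ENat.addLECancellable_of_ne_top (by simp)).add_tsub_cancel_right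

lemma add_two_add_sub_two (a b : ℕ∞) : a + 2 + b - 2 = a + b := by
  rw [add_right_comm]; exact (ENat.addLECancellable_of_ne_top (by simp)).add_tsub_cancel_right

lemma add_add_two_sub_two (a b : ℕ∞) : a + (b + 2) - 2 = a + b := by
  rw [← add_assoc]; exact (ENat.addLECancellable_of_ne_top (by simp)).add_tsub_cancel_right

lemma add_one_sub_one (a : ℕ∞) : a + 1 - 1 = a := (ENat.addLECancellable_of_ne_top (by simp)).add_tsub_cancel_right

lemma add_two_sub_two (a : ℕ∞) : a + 2 - 2 = a := (ENat.addLECancellable_of_ne_top (by simp)).add_tsub_cancel_right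

lemma min_min_choice {α : Type*} [LinearOrder α] (a b c : α) :
    min (min a b) c = a ∨ min (min a b) c = b ∨ min (min a b) c = c := by
  grind

/-- The hypotheses are the bounds of `TableBounds` with `c01 = γ + 1`, that is, with the offset of
`c01` removed. -/
lemma cutCost_mono {c0 c1 c2 c00 γ : ℕ∞} (h1 : c00 ≤ γ) (h2 : γ ≤ c0) (x : ℕ) :
    Monotone (cutCost c0 c1 c2 c00 (γ + 1) x) := by
  refine monotone_nat_of_le_succ fun a => ?_
  match x, a with
  | 0, 0 => simpa [cutCost, add_one_sub_one] using h1
  | 0, 1 => simpa [cutCost, add_one_sub_one] using h2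
  | 0, a + 2 => simp [cutCost]
  | 1, _ => simp [cutCost]
  | 2, _ => simp [cutCost]
  | _ + 3, _ => simp [cutCost]

/-- The child has value `0`, and then needs `2 - F` from below, or it carries the whole total `F` of
the block, and then nothing else there is nonzero. The terms of the update list these choices. -/
lemma blockStep {b0 b1 b2 b01 b02 c0 c1 c2 c00 c01 : ℕ∞}
    (hb1 : 1 ≤ b01) (hb2 : 2 ≤ b02) (hc1 : c00 + 1 ≤ c01) (hc2 : c01 ≤ c0 + 1) :
    BlockStep (blockCost b0 b1 b2 b01 b02) (cutCost c0 c1 c2 c00 c01)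
      (blockCost (b0 + c0) (min (b1 + c01 - 1) (b01 + c1 - 1)) (min (b2 + c00) (b02 + c2 - 2))
        (b01 + c01 - 1) (b02 + c00)) := by
  -- Writing `b01 = β + 1`, `b02 = δ + 2`, `c01 = γ + 1` makes the truncated subtractions cancel,
  -- also when an entry is `⊤`.
  obtain ⟨β, rfl⟩ := exists_add_of_le hb1
  obtain ⟨δ, rfl⟩ := exists_add_of_le hb2
  obtain ⟨γ, rfl⟩ := exists_add_of_le (le_trans le_add_self hc1)
  rw [add_comm 1 β, add_comm 2 δ, add_comm 1 γ] at *
  have hc1' : c00 ≤ γ := by simpa using hc1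
  have hc2' : γ ≤ c0 := by simpa using hc2
  rw [add_one_add_sub_one, add_two_add_sub_two, add_add_one_sub_one, add_one_add_sub_one]
  have hmono := cutCost_mono (c1 := c1) (c2 := c2) hc1' hc2'
  constructor
  · intro F s x a h0 h1 h2
    by_cases hbad : 3 ≤ F ∨ (s ≠ 0 ∧ s ≠ F)
    · rw [blockCost_eq_top hbad, top_add]; exact le_top
    by_cases hx : x = 0
    · subst hx
      have ha := h1 rfl
      -- The block supplies `F`, so the guarantee may be weakened to exactly `2 - F`, the entry that
      -- the update uses.
      have hle := hmono 0 (show 2 - F ≤ a by omega)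
      refine le_trans ?_ (add_le_add_right hle _)
      obtain ⟨rfl, rfl⟩ | ⟨rfl, rfl⟩ | ⟨rfl, rfl⟩ | ⟨rfl, rfl⟩ | ⟨rfl, rfl⟩ :
        (F = 0 ∧ s = 0) ∨ (F = 1 ∧ s = 0) ∨ (F = 1 ∧ s = 1) ∨ (F = 2 ∧ s = 0) ∨
          (F = 2 ∧ s = 2) := by omega
      all_goals simp [blockCost, cutCost, add_one_sub_one, add_two_sub_two, add_right_comm,
        ← add_assoc]
    · obtain rfl : x = F := by omega
      obtain rfl : s = 0 := by omega
      obtain rfl | rfl : x = 1 ∨ x = 2 := by omega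
      all_goals simp [blockCost, cutCost, add_one_sub_one, add_two_sub_two]
  · intro F s' hne
    have hbad : ¬ (3 ≤ F ∨ (s' ≠ 0 ∧ s' ≠ F)) := fun h => hne (blockCost_eq_top h)
    obtain ⟨rfl, rfl⟩ | ⟨rfl, rfl⟩ | ⟨rfl, rfl⟩ | ⟨rfl, rfl⟩ | ⟨rfl, rfl⟩ :
        (F = 0 ∧ s' = 0) ∨ (F = 1 ∧ s' = 0) ∨ (F = 2 ∧ s' = 0) ∨ (F = 1 ∧ s' = 1) ∨
          (F = 2 ∧ s' = 2) := by omega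
    · exact ⟨0, 0, 2, rfl, by simp, by simp, le_rfl⟩
    · exact ⟨0, 0, 1, rfl, by simp, by simp, by
        simp [blockCost, cutCost, add_one_sub_one, ← add_assoc]⟩
    · exact ⟨0, 0, 0, rfl, by simp, by simp, by
        simp [blockCost, cutCost, add_two_sub_two, add_right_comm]⟩
    · rcases min_choice (b1 + γ) (β + c1) with h | h
      · exact ⟨1, 0, 1, rfl, by simp, by simp, by simp [blockCost, cutCost, h, add_one_sub_one]⟩
      · exact ⟨0, 1, 0, rfl, by simp, by simp, by simp [blockCost, cutCost, h, add_one_sub_one]⟩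
    · rcases min_choice (b2 + c00) (δ + c2) with h | h
      · exact ⟨2, 0, 0, rfl, by simp, by simp, by simp [blockCost, cutCost, h]⟩
      · exact ⟨0, 2, 0, rfl, by simp, by simp, by simp [blockCost, cutCost, h, add_two_sub_two]⟩

/-- A nonzero value `x` of the parent is the whole total of the child block, whose own share is then
`0`. If `x = 0`, the child supplies its share `0`, `1` or `2`, and the terms of each minimum are the
ways to split the demand between it and the blocks eliminated before. -/
lemma cutStep {b0 b1 b2 b01 b02 c0 c1 c2 c00 c01 : ℕ∞}
    (hb1 : 1 ≤ b01) (hb2 : 2 ≤ b02) (hc1 : c00 + 1 ≤ c01) (hc2 : c01 ≤ c0 + 1) :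
    CutStep (cutCost c0 c1 c2 c00 c01) (blockCost b0 b1 b2 b01 b02)
      (cutCost (min (min (c0 + b0) (c01 + b1 - 1)) (c00 + b2)) (c1 + b01 - 1) (c2 + b02 - 2)
        (c00 + min (min b0 b1) b2)
        (min (min (c01 + b0) (c00 + b1 + 1)) (c00 + b2 + 1))) := by
  obtain ⟨β, rfl⟩ := exists_add_of_le hb1
  obtain ⟨δ, rfl⟩ := exists_add_of_le hb2
  obtain ⟨γ, rfl⟩ := exists_add_of_le (le_trans le_add_self hc1)
  rw [add_comm 1 β, add_comm 2 δ, add_comm 1 γ] at *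
  have hc1' : c00 ≤ γ := by simpa using hc1
  have hc2' : γ ≤ c0 := by simpa using hc2
  rw [add_one_add_sub_one, add_add_two_sub_two, add_add_one_sub_one,
    add_right_comm γ, min_add_add_right, min_add_add_right]
  constructor
  · intro x a s h
    by_cases hx : x = 0
    · subst hx
      by_cases hs : 3 ≤ s
      · rw [blockCost_eq_top (.inl (by omega)), add_top]; exact le_top
      obtain rfl | rfl | rfl : s = 0 ∨ s = 1 ∨ s = 2 := by omega
      all_goals
      match a with
      | 0 => simp [cutCost, blockCost, add_one_sub_one] <;> (gcongr; simp)
      | 1 =>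
        simp [cutCost, blockCost, add_one_sub_one, add_le_add_left hc1']
      | a + 2 =>
        simp [cutCost, blockCost,
          add_le_add_left hc2', add_le_add_left (hc1'.trans hc2')]
    · obtain rfl : s = 0 := by omega
      by_cases hx3 : 3 ≤ x
      · rw [cutCost_eq_top hx3, cutCost_eq_top hx3]; simp
      obtain rfl | rfl : x = 1 ∨ x = 2 := by omega
      all_goals simp [cutCost, blockCost, add_one_sub_one, add_two_sub_two]
  · intro x a' hne
    have hx : ¬ 3 ≤ x := fun h => hne (cutCost_eq_top h)
    obtain rfl | rfl | rfl : x = 0 ∨ x = 1 ∨ x = 2 := by omega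
    · match a' with
      | 0 =>
        rcases min_min_choice b0 b1 b2 with h | h | h
        · exact ⟨0, 0, by simp, by simp, by simp [cutCost, blockCost, h]⟩
        · exact ⟨0, 1, by simp, by simp, by simp [cutCost, blockCost, h]⟩
        · exact ⟨0, 2, by simp, by simp, by simp [cutCost, blockCost, h]⟩
      | 1 =>
        rcases min_min_choice (γ + b0) (c00 + b1) (c00 + b2) with h | h | h
        · exact ⟨1, 0, by simp, by simp, by simp [cutCost, blockCost, h, add_one_sub_one]⟩
        · exact ⟨0, 1, by simp, by simp, by simp [cutCost, blockCost, h, add_one_sub_one]⟩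
        · exact ⟨0, 2, by simp, by simp, by simp [cutCost, blockCost, h, add_one_sub_one]⟩
      | a' + 2 =>
        rcases min_min_choice (c0 + b0) (γ + b1) (c00 + b2) with h | h | h
        · exact ⟨2, 0, by simp, by simp, by simp [cutCost, blockCost, h]⟩
        · exact ⟨1, 1, by simp, by simp, by simp [cutCost, blockCost, h, add_one_sub_one]⟩
        · exact ⟨0, 2, by simp, by simp, by simp [cutCost, blockCost, h]⟩
    · exact ⟨a', 0, by simp, by simp, by simp [cutCost, blockCost, add_one_sub_one]⟩
    · exact ⟨a', 0, by simp, by simp, by simp [cutCost, blockCost, add_two_sub_two]⟩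

/-- The inequalities between the tables of a cut-vertex are preserved by an update. -/
lemma cut_table_bounds {b0 b1 b2 c0 c00 c01 : ℕ∞} (hc1 : c00 + 1 ≤ c01) (hc2 : c01 ≤ c0 + 1) :
    c00 + min (min b0 b1) b2 + 1 ≤ min (min (c01 + b0) (c00 + b1 + 1)) (c00 + b2 + 1) ∧
    min (min (c01 + b0) (c00 + b1 + 1)) (c00 + b2 + 1) ≤
      min (min (c0 + b0) (c01 + b1 - 1)) (c00 + b2) + 1 := by
  obtain ⟨γ, rfl⟩ := exists_add_of_le (le_trans le_add_self hc1)
  rw [add_comm 1 γ] at *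
  have hc1' : c00 ≤ γ := by simpa using hc1
  have hc2' : γ ≤ c0 := by simpa using hc2
  rw [add_one_add_sub_one, add_right_comm γ, min_add_add_right, min_add_add_right]
  constructor
  · gcongr
    refine le_min (le_min ?_ ?_) ?_
    · exact add_le_add hc1' (by simp)
    · gcongr; simp
    · gcongr; simp
  · gcongr

/-! ### Running the program -/

section Execution

lemma foldl_range'_induction {p : Prog} {r : Reg} {P : ℕ → Memory → Prop} {c : ℕ} (m : ℕ) :
    ∀ (a : ℕ) (st : Memory × ℕ), P a st.1 →
      (∀ k s, a ≤ k → k < a + m → P k s →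
        P (k + 1) (p.exec (s.setReg r k)).1 ∧ (p.exec (s.setReg r k)).2 ≤ c) →
      P (a + m) ((List.range' a m).foldl (fun st k =>
        ((p.exec (st.1.setReg r k)).1, st.2 + 1 + (p.exec (st.1.setReg r k)).2)) st).1 ∧
      ((List.range' a m).foldl (fun st k =>
        ((p.exec (st.1.setReg r k)).1, st.2 + 1 + (p.exec (st.1.setReg r k)).2)) st).2 ≤
        st.2 + m * (c + 1) := by
  induction m with
  | zero => intro a st h _; simpa using h
  | succ m ih =>
    intro a st h hstep
    rw [List.range'_succ, List.foldl_cons]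
    obtain ⟨h1, h2⟩ := hstep a st.1 le_rfl (by omega) h
    obtain ⟨h3, h4⟩ := ih (a + 1) ((p.exec (st.1.setReg r a)).1,
      st.2 + 1 + (p.exec (st.1.setReg r a)).2) h1
      fun k s hk hk' => hstep k s (by omega) (by omega)
    refine ⟨by rwa [add_right_comm, add_assoc] at h3, h4.trans ?_⟩
    simp only
    rw [Nat.succ_mul]
    omega

lemma exec_loop_induction {p : Prog} {r : Reg} {lo hi : IExp} {s : Memory}
    (P : ℕ → Memory → Prop) (c : ℕ) (hle : lo.eval s ≤ hi.eval s) (h0 : P (lo.eval s) s)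
    (hstep : ∀ k s', lo.eval s ≤ k → k < hi.eval s → P k s' →
      P (k + 1) (p.exec (s'.setReg r k)).1 ∧ (p.exec (s'.setReg r k)).2 ≤ c) :
    P (hi.eval s) ((Prog.loop r lo hi p).exec s).1 ∧
      ((Prog.loop r lo hi p).exec s).2 ≤
        lo.cost + hi.cost + 1 + (hi.eval s - lo.eval s) * (c + 1) := by
  have := foldl_range'_induction (p := p) (r := r) (P := P) (c := c)
    (hi.eval s - lo.eval s) (lo.eval s) (s, lo.cost + hi.cost + 1) h0
    fun k s' hk hk' => hstep k s' hk (by omega)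
  rwa [Nat.add_sub_cancel' hle] at this

/-- The cells of position `i` hold the initial values for the label `kind`. -/
def Initialized (s : Memory) (kind i : ℕ) : Prop :=
  if kind = 3 then
    s.arr .c0 i = ⊤ ∧ s.arr .c1 i = 1 ∧ s.arr .c2 i = 2 ∧ s.arr .c00 i = 0 ∧ s.arr .c01 i = ⊤
  else if kind = 0 then
    s.arr .b0 i = 0 ∧ s.arr .b1 i = ⊤ ∧ s.arr .b2 i = ⊤ ∧ s.arr .b01 i = 1 ∧ s.arr .b02 i = 2
  else if kind = 1 then
    s.arr .b0 i = ⊤ ∧ s.arr .b1 i = 1 ∧ s.arr .b2 i = ⊤ ∧ s.arr .b01 i = ⊤ ∧ s.arr .b02 i = 2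
  else
    s.arr .b0 i = ⊤ ∧ s.arr .b1 i = ⊤ ∧ s.arr .b2 i = 2 ∧ s.arr .b01 i = ⊤ ∧ s.arr .b02 i = 2

lemma exec_ifEq_pos {e₁ e₂ : IExp} {p q : Prog} {s : Memory} (h : e₁.eval s = e₂.eval s) :
    (Prog.ifEq e₁ e₂ p q).exec s = ((p.exec s).1, e₁.cost + e₂.cost + 1 + (p.exec s).2) := by
  rw [Prog.exec, if_pos h]

lemma exec_ifEq_neg {e₁ e₂ : IExp} {p q : Prog} {s : Memory} (h : e₁.eval s ≠ e₂.eval s) :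
    (Prog.ifEq e₁ e₂ p q).exec s = ((q.exec s).1, e₁.cost + e₂.cost + 1 + (q.exec s).2) := by
  rw [Prog.exec, if_neg h]

lemma exec_initCut (s : Memory) (x₀ x₁ x₂ x₃ x₄ : ℕ∞) :
    ((initCut x₀ x₁ x₂ x₃ x₄).exec s).1.tab = s.tab ∧
    ((initCut x₀ x₁ x₂ x₃ x₄).exec s).1.reg = s.reg ∧
    (∀ a k, k ≠ s.reg .cur → ((initCut x₀ x₁ x₂ x₃ x₄).exec s).1.arr a k = s.arr a k) ∧
    (((initCut x₀ x₁ x₂ x₃ x₄).exec s).1.arr .c0 (s.reg .cur) = x₀ ∧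
    ((initCut x₀ x₁ x₂ x₃ x₄).exec s).1.arr .c1 (s.reg .cur) = x₁ ∧
    ((initCut x₀ x₁ x₂ x₃ x₄).exec s).1.arr .c2 (s.reg .cur) = x₂ ∧
    ((initCut x₀ x₁ x₂ x₃ x₄).exec s).1.arr .c00 (s.reg .cur) = x₃ ∧
    ((initCut x₀ x₁ x₂ x₃ x₄).exec s).1.arr .c01 (s.reg .cur) = x₄) ∧
    ((initCut x₀ x₁ x₂ x₃ x₄).exec s).2 ≤ 20 := by
  unfold initCut
  simp only [Prog.exec, IExp.eval, NExp.eval, IExp.cost, NExp.cost]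
  refine ⟨rfl, rfl, ?_, ?_, by norm_num⟩
  · intro a k hk; cases a <;> simp [Memory.setArr, hk]
  · simp [Memory.setArr]

lemma exec_initBlock (s : Memory) (x₀ x₁ x₂ x₃ x₄ : ℕ∞) :
    ((initBlock x₀ x₁ x₂ x₃ x₄).exec s).1.tab = s.tab ∧
    ((initBlock x₀ x₁ x₂ x₃ x₄).exec s).1.reg = s.reg ∧
    (∀ a k, k ≠ s.reg .cur → ((initBlock x₀ x₁ x₂ x₃ x₄).exec s).1.arr a k = s.arr a k) ∧
    (((initBlock x₀ x₁ x₂ x₃ x₄).exec s).1.arr .b0 (s.reg .cur) = x₀ ∧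
    ((initBlock x₀ x₁ x₂ x₃ x₄).exec s).1.arr .b1 (s.reg .cur) = x₁ ∧
    ((initBlock x₀ x₁ x₂ x₃ x₄).exec s).1.arr .b2 (s.reg .cur) = x₂ ∧
    ((initBlock x₀ x₁ x₂ x₃ x₄).exec s).1.arr .b01 (s.reg .cur) = x₃ ∧
    ((initBlock x₀ x₁ x₂ x₃ x₄).exec s).1.arr .b02 (s.reg .cur) = x₄) ∧
    ((initBlock x₀ x₁ x₂ x₃ x₄).exec s).2 ≤ 20 := by
  unfold initBlock
  simp only [Prog.exec, IExp.eval, NExp.eval, IExp.cost, NExp.cost]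
  refine ⟨rfl, rfl, ?_, ?_, by norm_num⟩
  · intro a k hk; cases a <;> simp [Memory.setArr, hk]
  · simp [Memory.setArr]

lemma exec_initVertex (s : Memory) :
    (initVertex.exec s).1.tab = s.tab ∧ (initVertex.exec s).1.reg = s.reg ∧
    (∀ a k, k ≠ s.reg .cur → (initVertex.exec s).1.arr a k = s.arr a k) ∧
    Initialized (initVertex.exec s).1 (s.tab .kind (s.reg .cur)) (s.reg .cur) ∧
    (initVertex.exec s).2 ≤ 40 := by
  unfold initVertex Initialized
  have hk : ∀ k, s.tab .kind (s.reg .cur) = k ↔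
    (IExp.tab .kind vi).eval s = (IExp.lit k).eval s := fun _ => Iff.rfl
  have hcost : (IExp.tab .kind vi).cost = 2 := rfl
  have hcost' : ∀ k, (IExp.lit k).cost = 1 := fun _ => rfl
  by_cases h3 : s.tab .kind (s.reg .cur) = 3
  · rw [exec_ifEq_pos ((hk _).1 h3), if_pos h3, hcost, hcost']
    obtain ⟨e1, e2, e3, e4, e5⟩ := exec_initCut s ⊤ 1 2 0 ⊤
    exact ⟨e1, e2, e3, e4, by simp only; omega⟩
  rw [exec_ifEq_neg (mt (hk _).2 h3), if_neg h3]
  by_cases h0 : s.tab .kind (s.reg .cur) = 0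
  · rw [exec_ifEq_pos ((hk _).1 h0), if_pos h0, hcost, hcost', hcost']
    obtain ⟨e1, e2, e3, e4, e5⟩ := exec_initBlock s 0 ⊤ ⊤ 1 2
    exact ⟨e1, e2, e3, e4, by simp only; omega⟩
  rw [exec_ifEq_neg (mt (hk _).2 h0), if_neg h0]
  by_cases h1 : s.tab .kind (s.reg .cur) = 1
  · rw [exec_ifEq_pos ((hk _).1 h1), if_pos h1, hcost, hcost', hcost', hcost']
    obtain ⟨e1, e2, e3, e4, e5⟩ := exec_initBlock s ⊤ 1 ⊤ ⊤ 2
    exact ⟨e1, e2, e3, e4, by simp only; omega⟩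
  · rw [exec_ifEq_neg (mt (hk _).2 h1), if_neg h1, hcost, hcost', hcost', hcost']
    obtain ⟨e1, e2, e3, e4, e5⟩ := exec_initBlock s ⊤ ⊤ 2 ⊤ 2
    exact ⟨e1, e2, e3, e4, by simp only; omega⟩

/-- The order of the assignments matters: `b01` and `b02` are overwritten only after `b1` and `b2`
have read them, so all right-hand sides see old values. -/
lemma exec_updateBlock (s : Memory) :
    (updateBlock.exec s).1.tab = s.tab ∧ (updateBlock.exec s).1.reg = s.reg ∧
    (∀ a k, k ≠ s.reg .par → (updateBlock.exec s).1.arr a k = s.arr a k) ∧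
    (updateBlock.exec s).1.arr .b0 (s.reg .par) =
      s.arr .b0 (s.reg .par) + s.arr .c0 (s.reg .cur) ∧
    (updateBlock.exec s).1.arr .b1 (s.reg .par) =
      min (s.arr .b1 (s.reg .par) + s.arr .c01 (s.reg .cur) - 1)
        (s.arr .b01 (s.reg .par) + s.arr .c1 (s.reg .cur) - 1) ∧
    (updateBlock.exec s).1.arr .b2 (s.reg .par) =
      min (s.arr .b2 (s.reg .par) + s.arr .c00 (s.reg .cur))
        (s.arr .b02 (s.reg .par) + s.arr .c2 (s.reg .cur) - 2) ∧
    (updateBlock.exec s).1.arr .b01 (s.reg .par) =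
      s.arr .b01 (s.reg .par) + s.arr .c01 (s.reg .cur) - 1 ∧
    (updateBlock.exec s).1.arr .b02 (s.reg .par) =
      s.arr .b02 (s.reg .par) + s.arr .c00 (s.reg .cur) ∧
    (updateBlock.exec s).2 ≤ 70 := by
  unfold updateBlock
  simp only [Prog.exec, IExp.eval, NExp.eval, IExp.cost, NExp.cost]
  refine ⟨rfl, rfl, ?_, ?_, ?_, ?_, ?_, ?_, by norm_num⟩
  · intro a k hk; cases a <;> simp [Memory.setArr, hk]
  all_goals simp [Memory.setArr]

lemma exec_updateCut (s : Memory) :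
    (updateCut.exec s).1.tab = s.tab ∧ (updateCut.exec s).1.reg = s.reg ∧
    (∀ a k, k ≠ s.reg .par → (updateCut.exec s).1.arr a k = s.arr a k) ∧
    (updateCut.exec s).1.arr .c0 (s.reg .par) =
      min (min (s.arr .c0 (s.reg .par) + s.arr .b0 (s.reg .cur))
        (s.arr .c01 (s.reg .par) + s.arr .b1 (s.reg .cur) - 1))
        (s.arr .c00 (s.reg .par) + s.arr .b2 (s.reg .cur)) ∧
    (updateCut.exec s).1.arr .c1 (s.reg .par) =
      s.arr .c1 (s.reg .par) + s.arr .b01 (s.reg .cur) - 1 ∧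
    (updateCut.exec s).1.arr .c2 (s.reg .par) =
      s.arr .c2 (s.reg .par) + s.arr .b02 (s.reg .cur) - 2 ∧
    (updateCut.exec s).1.arr .c00 (s.reg .par) =
      s.arr .c00 (s.reg .par) +
        min (min (s.arr .b0 (s.reg .cur)) (s.arr .b1 (s.reg .cur))) (s.arr .b2 (s.reg .cur)) ∧
    (updateCut.exec s).1.arr .c01 (s.reg .par) =
      min (min (s.arr .c01 (s.reg .par) + s.arr .b0 (s.reg .cur))
        (s.arr .c00 (s.reg .par) + s.arr .b1 (s.reg .cur) + 1))
        (s.arr .c00 (s.reg .par) + s.arr .b2 (s.reg .cur) + 1) ∧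
    (updateCut.exec s).2 ≤ 90 := by
  unfold updateCut
  simp only [Prog.exec, IExp.eval, NExp.eval, IExp.cost, NExp.cost]
  refine ⟨rfl, rfl, ?_, ?_, ?_, ?_, ?_, ?_, by norm_num⟩
  · intro a k hk; cases a <;> simp [Memory.setArr, hk]
  all_goals simp [Memory.setArr]

variable {n : ℕ} {A : Fin n → Fin n → Prop} {cut : Fin n → Prop}

open Classical in
/-- The cost tables held by the memory. -/
noncomputable def tableCost (cut : Fin n → Prop) (s : Memory) (i : Fin n) : ℕ → ℕ → ℕ∞ :=
  if cut i then cutCost (s.arr .c0 i) (s.arr .c1 i) (s.arr .c2 i) (s.arr .c00 i) (s.arr .c01 i)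
  else blockCost (s.arr .b0 i) (s.arr .b1 i) (s.arr .b2 i) (s.arr .b01 i) (s.arr .b02 i)

/-- Inequalities between the cells of a position which make the subtractions harmless. -/
def TableBounds (cut : Fin n → Prop) (s : Memory) : Prop :=
  ∀ i : Fin n,
    (cut i → s.arr .c00 i + 1 ≤ s.arr .c01 i ∧ s.arr .c01 i ≤ s.arr .c0 i + 1) ∧
    (¬ cut i → 1 ≤ s.arr .b01 i ∧ 2 ≤ s.arr .b02 i)

lemma tableCost_congr {s s' : Memory} {i : Fin n} (h : ∀ a, s'.arr a i = s.arr a i) :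
    tableCost cut s' i = tableCost cut s i := by
  simp [tableCost, h]

/-- The elimination of one position. -/
def eliminate : Prog :=
  .setReg .par (.tab .parent vi) ;; .ifEq (.tab .kind vi) (.lit 3) updateBlock updateCut

/-- The loop body realizes the elimination of `minCost_succ`, and the bounds that justify its
subtractions survive. -/
lemma exec_eliminate {s : Memory} {t j : Fin n} (hsymm : ∀ i k, A i k → A k i)
    (hbip : ∀ i k, A i k → (cut i ↔ ¬ cut k)) (htj : t < j) (hA : A t j)
    (huniq : ∀ k, t < k → A t k → k = j) (hcur : s.reg .cur = t) (hpar : s.tab .parent t = j)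
    (hkind : s.tab .kind t = 3 ↔ cut t) (hs : TableBounds cut s) :
    TableBounds cut (eliminate.exec s).1 ∧
    minCost A cut (tableCost cut (eliminate.exec s).1) (t + 1) =
      minCost A cut (tableCost cut s) t ∧
    (eliminate.exec s).1.tab = s.tab ∧ (eliminate.exec s).1.reg .size = s.reg .size ∧
    (eliminate.exec s).2 ≤ 100 := by
  set s₁ : Memory := s.setReg .par j with hs₁
  have hcur₁ : s₁.reg .cur = t := by simp [hs₁, Memory.setReg, hcur]
  have hpar₁ : s₁.reg .par = j := by simp [hs₁, Memory.setReg]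
  have hsize₁ : s₁.reg .size = s.reg .size := by simp [hs₁, Memory.setReg]
  have harr₁ : s₁.arr = s.arr := rfl
  have htab₁ : s₁.tab = s.tab := rfl
  -- The constant `7` is `3` steps for loading the parent and `4` for the test of the label.
  have hexec : ∀ p, (p = if s.tab .kind t = 3 then updateBlock else updateCut) →
      eliminate.exec s = ((p.exec s₁).1, 7 + (p.exec s₁).2) := by
    rintro p rfl
    have h1 : (Prog.setReg .par (.tab .parent vi)).exec s = (s₁, 3) := by
      simp only [Prog.exec, IExp.eval, IExp.cost, hcur, hpar, ← hs₁]
    have h2 : (IExp.tab .kind vi).eval s₁ = s.tab .kind t := by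
      simp only [IExp.eval, hcur₁, htab₁]
    unfold eliminate
    rw [Prog.exec, h1]
    split_ifs with h
    · rw [exec_ifEq_pos (h2.trans (show _ = (IExp.lit 3).eval s₁ from h))]
      simp only [IExp.cost]
      congr 1
    · rw [exec_ifEq_neg (fun h' => h (h2.symm.trans h'))]
      simp only [IExp.cost]
      congr 1
  have hbt := hs t
  have hbj := hs j
  by_cases ht : cut t
  · have hj : ¬ cut j := by have := hbip _ _ hA; tauto
    rw [hexec _ (if_pos (hkind.2 ht)).symm]
    obtain ⟨h1, h2, h3, h4, h5, h6, h7, h8, h9⟩ := exec_updateBlock s₁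
    rw [hpar₁, hcur₁, harr₁] at *
    set s₂ := (updateBlock.exec s₁).1
    have hcong : ∀ i : Fin n, i ≠ j → ∀ a, s₂.arr a i = s.arr a i := fun i hi a =>
      h3 a i (Fin.val_ne_of_ne hi)
    refine ⟨?_, ?_, h1.trans htab₁, by rw [h2, hsize₁], by simp only; omega⟩
    · intro i
      rcases eq_or_ne i j with rfl | hij
      · refine ⟨fun h => absurd h hj, fun _ => ?_⟩
        obtain ⟨γ, hγ⟩ := exists_add_of_le (le_trans le_add_self (hbt.1 ht).1)
        rw [h7, h8, hγ, add_comm 1 γ, add_add_one_sub_one]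
        exact ⟨(hbj.2 hj).1.trans le_self_add, (hbj.2 hj).2.trans le_self_add⟩
      · simpa only [hcong i hij] using hs i
    · refine minCost_succ hsymm hbip htj hA huniq (fun i hi => tableCost_congr (hcong i hi))
        (fun h => absurd h hj) fun _ => ?_
      simp only [tableCost, if_pos ht, if_neg hj, h4, h5, h6, h7, h8]
      exact blockStep (hbj.2 hj).1 (hbj.2 hj).2 (hbt.1 ht).1 (hbt.1 ht).2
  · have hj : cut j := by have := hbip _ _ hA; tauto
    rw [hexec _ (if_neg fun h => ht (hkind.1 h)).symm]
    obtain ⟨h1, h2, h3, h4, h5, h6, h7, h8, h9⟩ := exec_updateCut s₁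
    rw [hpar₁, hcur₁, harr₁] at *
    set s₂ := (updateCut.exec s₁).1
    have hcong : ∀ i : Fin n, i ≠ j → ∀ a, s₂.arr a i = s.arr a i := fun i hi a =>
      h3 a i (Fin.val_ne_of_ne hi)
    refine ⟨?_, ?_, h1.trans htab₁, by rw [h2, hsize₁], by simp only; omega⟩
    · intro i
      rcases eq_or_ne i j with rfl | hij
      · refine ⟨fun _ => ?_, fun h => absurd hj h⟩
        rw [h4, h7, h8]
        exact cut_table_bounds (hbj.1 hj).1 (hbj.1 hj).2
      · simpa only [hcong i hij] using hs i
    · refine minCost_succ hsymm hbip htj hA huniq (fun i hi => tableCost_congr (hcong i hi))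
        (fun _ => ?_) fun h => absurd hj h
      simp only [tableCost, if_neg ht, if_pos hj, h4, h5, h6, h7, h8]
      exact cutStep (hbt.2 ht).1 (hbt.2 ht).2 (hbj.1 hj).1 (hbj.1 hj).2

/-- At the root nothing is left to receive from: a cut-vertex of value `0` must already be
guaranteed `2`, and the total of a block equals its share. This singles out the entries that the
algorithm returns. -/
lemma consistent_last_iff {t : Fin n} (ht : (t : ℕ) + 1 = n) (hself : ¬ A t t)
    {p q : Fin n → ℕ} :
    Consistent A cut t p q ↔ (cut t → p t = 0 → 2 ≤ q t) ∧ (¬ cut t → p t = q t) := by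
  have hlast : ∀ i : Fin n, (t : ℕ) ≤ i → i = t := fun i hi => Fin.ext (by omega)
  have hrest : restSum A t p t = 0 := by
    classical
    unfold restSum
    refine Finset.sum_eq_zero fun k hk => ?_
    simp only [Finset.mem_filter, Finset.mem_univ, true_and] at hk
    rw [hlast k hk.1] at hk
    exact absurd hk.2 hself
  constructor
  · intro h
    have := h t le_rfl
    rw [hrest, add_zero] at this
    exact ⟨this.1, fun h => (this.2 h).1⟩
  · intro h i hi
    rw [hlast i hi, hrest, add_zero]
    exact ⟨h.1, fun hc => ⟨h.2 hc, fun k hk hk' => absurd (hlast k hk ▸ hk') hself⟩⟩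

lemma totalCost_last {κ : Fin n → ℕ → ℕ → ℕ∞} {t : Fin n} (ht : (t : ℕ) + 1 = n)
    (p q : Fin n → ℕ) : totalCost κ t p q = κ t (p t) (q t) := by
  unfold totalCost
  rw [show (Finset.univ.filter fun i : Fin n => (t : ℕ) ≤ i) = {t} from ?_]
  · simp
  · ext i
    simp only [Finset.mem_filter, Finset.mem_univ, true_and, Finset.mem_singleton, Fin.ext_iff]
    omega

lemma minCost_last_cut {κ : Fin n → ℕ → ℕ → ℕ∞} {t : Fin n} {c0 c1 c2 c00 c01 : ℕ∞}
    (ht : (t : ℕ) + 1 = n) (hself : ¬ A t t) (hc : cut t)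
    (hκ : κ t = cutCost c0 c1 c2 c00 c01) : minCost A cut κ t = min (min c0 c1) c2 := by
  apply le_antisymm
  · have key : ∀ x a, (x = 0 → 2 ≤ a) → minCost A cut κ t ≤ κ t x a := fun x a h =>
      iInf_le_of_le (fun _ => x) (iInf_le_of_le (fun _ => a) (iInf_le_of_le
        ((consistent_last_iff ht hself).2 ⟨fun _ => h, fun h => absurd hc h⟩)
        (totalCost_last ht _ _).le))
    rw [hκ] at key
    exact le_min (le_min (key 0 2 (by simp)) (key 1 0 (by simp))) (key 2 0 (by simp))
  · refine le_iInf fun p => le_iInf fun q => le_iInf fun h => ?_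
    rw [totalCost_last ht, hκ]
    have h' := ((consistent_last_iff ht hself).1 h).1 hc
    by_cases h3 : 3 ≤ p t
    · rw [cutCost_eq_top h3]; exact le_top
    obtain hp | hp | hp : p t = 0 ∨ p t = 1 ∨ p t = 2 := by omega
    · rw [hp, cutCost_zero_of_two_le (h' hp)]; simp
    · rw [hp]; simp [cutCost]
    · rw [hp]; simp [cutCost]

lemma minCost_last_block {κ : Fin n → ℕ → ℕ → ℕ∞} {t : Fin n} {b0 b1 b2 b01 b02 : ℕ∞}
    (ht : (t : ℕ) + 1 = n) (hself : ¬ A t t) (hc : ¬ cut t)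
    (hκ : κ t = blockCost b0 b1 b2 b01 b02) : minCost A cut κ t = min (min b0 b1) b2 := by
  apply le_antisymm
  · have key : ∀ x, minCost A cut κ t ≤ κ t x x := fun x =>
      iInf_le_of_le (fun _ => x) (iInf_le_of_le (fun _ => x) (iInf_le_of_le
        ((consistent_last_iff ht hself).2 ⟨fun h => absurd h hc, fun _ => rfl⟩)
        (totalCost_last ht _ _).le))
    rw [hκ] at key
    exact le_min (le_min (key 0) (key 1)) (key 2)
  · refine le_iInf fun p => le_iInf fun q => le_iInf fun h => ?_
    rw [totalCost_last ht, hκ, ← ((consistent_last_iff ht hself).1 h).2 hc]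
    by_cases h3 : 3 ≤ p t
    · rw [blockCost_eq_top (.inl h3)]; exact le_top
    obtain hp | hp | hp : p t = 0 ∨ p t = 1 ∨ p t = 2 := by omega
    all_goals rw [hp]; simp [blockCost]

/-- The initial cost tables. -/
noncomputable def initCost (kind : ℕ) : ℕ → ℕ → ℕ∞ :=
  if kind = 3 then cutCost ⊤ 1 2 0 ⊤
  else if kind = 0 then blockCost 0 ⊤ ⊤ 1 2
  else if kind = 1 then blockCost ⊤ 1 ⊤ ⊤ 2
  else blockCost ⊤ ⊤ 2 ⊤ 2

lemma Initialized.congr {s s' : Memory} {kind i : ℕ} (h : Initialized s kind i)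
    (harr : ∀ a, s'.arr a i = s.arr a i) : Initialized s' kind i := by
  unfold Initialized at *
  simpa only [harr] using h

lemma tableCost_of_initialized {s : Memory} {kind : Fin n → ℕ}
    (h : ∀ i : Fin n, Initialized s (kind i) i) :
    tableCost (fun i => kind i = 3) s = fun i => initCost (kind i) := by
  funext i
  have := h i
  unfold Initialized at this
  unfold tableCost initCost
  split_ifs at * <;> simp [this]

lemma tableBounds_of_initialized {s : Memory} {kind : Fin n → ℕ}
    (h : ∀ i : Fin n, Initialized s (kind i) i) : TableBounds (fun i => kind i = 3) s := by
  intro i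
  have := h i
  unfold Initialized at this
  split_ifs at * <;> simp_all

lemma setReg_reg_of_ne {s : Memory} {r r' : Reg} {k : ℕ} (h : r' ≠ r) :
    (s.setReg r k).reg r' = s.reg r' := by
  simp [Memory.setReg, h]

/-- The algorithm returns the least cost of consistent labels of all positions. -/
theorem exec_algorithm {s : Memory} {kind : Fin n → ℕ} (hn : 2 ≤ n)
    (hsymm : ∀ i k, A i k → A k i) (hbip : ∀ i k, A i k → (kind i = 3 ↔ ¬ kind k = 3))
    (htree : ∀ i : Fin n, (i : ℕ) + 1 < n → ∃! j, i < j ∧ A i j)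
    (hsize : s.reg .size = n) (hkind : ∀ i : Fin n, s.tab .kind i = kind i)
    (hpar : ∀ i j : Fin n, i < j ∧ A i j → s.tab .parent i = j) :
    (algorithm.exec s).1.result =
      minCost A (fun i => kind i = 3) (fun i => initCost (kind i)) 0 ∧
    (algorithm.exec s).2 ≤ 200 * n := by
  have hself : ∀ i, ¬ A i i := fun i h => by have := hbip _ _ h; tauto
  obtain ⟨⟨h1size, h1tab, h1init⟩, h1cost⟩ := exec_loop_induction (p := initVertex) (r := .cur)
    (lo := .lit 0) (hi := .reg .size) (s := s)
    (fun k s' => s'.reg .size = n ∧ s'.tab = s.tab ∧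
      ∀ i : Fin n, (i : ℕ) < k → Initialized s' (kind i) i) 40 (by simp [IExp.eval])
    ⟨hsize, rfl, by simp [IExp.eval]⟩ (by
      rintro k s' - hk ⟨h1, h2, h3⟩
      obtain ⟨e1, e2, e4, e3, e5⟩ := exec_initVertex (s'.setReg .cur k)
      have hcur : (s'.setReg .cur k).reg .cur = k := by simp [Memory.setReg]
      rw [hcur] at e3 e4
      refine ⟨⟨by rw [e2, setReg_reg_of_ne (by decide), h1], e1.trans h2, fun i hi => ?_⟩, e5⟩
      rcases eq_or_ne (i : ℕ) k with rfl | hik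
      · rw [show (s'.setReg .cur i).tab = s.tab from h2, hkind] at e3
        exact e3
      · exact (h3 i (by omega)).congr fun a => e4 a i hik)
  set s₁ := ((Prog.loop .cur (.lit 0) (.reg .size) initVertex).exec s).1 with hs₁
  have h1init' : ∀ i : Fin n, Initialized s₁ (kind i) i := fun i =>
    h1init i (by simp [IExp.eval, hsize])
  have hlast : ∀ s' : Memory, s'.reg .size = n → vLast.eval s' = n - 1 := fun s' h => by
    simp [IExp.eval, h]
  -- Loop invariant: the least cost of labels of the positions from `k` on, priced by the current
  -- memory, is the original minimum.
  obtain ⟨⟨h2size, h2tab, h2bounds, h2cost⟩, h2steps⟩ :=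
    exec_loop_induction (p := eliminate) (r := .cur)
    (lo := .lit 0) (hi := vLast) (s := s₁)
    (fun k s' => s'.reg .size = n ∧ s'.tab = s.tab ∧ TableBounds (fun i => kind i = 3) s' ∧
      minCost A (fun i => kind i = 3) (tableCost (fun i => kind i = 3) s') k =
        minCost A (fun i => kind i = 3) (fun i => initCost (kind i)) 0) 100
    (by simp [IExp.eval])
    ⟨h1size, h1tab, tableBounds_of_initialized h1init', by
      rw [tableCost_of_initialized h1init']; rfl⟩ (by
      rintro k s' - hk ⟨h1, h2, h3, h4⟩
      rw [hlast _ h1size] at hk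
      obtain ⟨j, ⟨hj1, hj2⟩, hj3⟩ := htree ⟨k, by omega⟩ (by simp only; omega)
      obtain ⟨e1, e2, e3, e4, e5⟩ := exec_eliminate (A := A) (cut := fun i => kind i = 3)
        (s := s'.setReg .cur k) (t := ⟨k, by omega⟩) (j := j) hsymm hbip hj1 hj2
        (fun i hi hi' => hj3 i ⟨hi, hi'⟩) (by simp [Memory.setReg])
        (by rw [show (s'.setReg .cur k).tab = s.tab from h2]; exact hpar _ _ ⟨hj1, hj2⟩)
        (by rw [show (s'.setReg .cur k).tab = s.tab from h2, hkind]) h3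
      exact ⟨⟨by rw [e4, setReg_reg_of_ne (by decide), h1], e3.trans h2, e1, e2.trans h4⟩, e5⟩)
  set s₂ := ((Prog.loop .cur (.lit 0) vLast eliminate).exec s₁).1 with hs₂
  have hlast₂ := hlast s₂ h2size
  rw [hlast s₁ h1size] at h2cost h2steps
  have hval : (IExp.reg .size).eval s = n := hsize
  rw [hval] at h1cost
  have hzero : ∀ s', (IExp.lit 0).eval s' = 0 := fun _ => rfl
  rw [hzero] at h1cost h2steps
  have hexec : ∀ p, (p = Prog.ifEq (.tab .kind vLast) (.lit 3)
      (.ret (.min (.min (.arr .c0 vLast) (.arr .c1 vLast)) (.arr .c2 vLast)))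
      (.ret (.min (.min (.arr .b0 vLast) (.arr .b1 vLast)) (.arr .b2 vLast)))) →
      algorithm.exec s = ((p.exec s₂).1,
        3 + (((Prog.loop .cur (.lit 0) (.reg .size) initVertex).exec s).2 +
          (((Prog.loop .cur (.lit 0) vLast eliminate).exec s₁).2 + (p.exec s₂).2))) := by
    rintro p rfl
    have hne : (IExp.reg .size).eval s ≠ (IExp.lit 1).eval s := by
      rw [hval]
      simp only [IExp.eval]
      omega
    unfold algorithm
    rw [exec_ifEq_neg hne]
    rfl
  set t : Fin n := ⟨n - 1, by omega⟩ with ht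
  have ht1 : (t : ℕ) + 1 = n := by simp only [ht]; omega
  rw [hexec _ rfl, ← h2cost]
  have hlit : ∀ k, (IExp.lit k).cost = 1 := fun _ => rfl
  have hreg : ∀ r, (IExp.reg r).cost = 1 := fun _ => rfl
  have hvl : vLast.cost = 3 := rfl
  have hret : ∀ x, (Prog.ret x).exec s₂ = ({ s₂ with result := x.eval s₂ }, x.cost + 1) :=
    fun _ => rfl
  rw [hlit, hreg] at h1cost
  rw [hlit, hvl] at h2steps
  have hkt : (IExp.tab .kind vLast).eval s₂ = kind t := by
    rw [← hkind t, ← h2tab, IExp.eval, hlast₂]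
  by_cases hc : kind t = 3
  · rw [exec_ifEq_pos (hkt.trans (show _ = (IExp.lit 3).eval s₂ from hc))]
    refine ⟨Eq.trans ?_ (minCost_last_cut (t := t) ht1 (hself t) hc (if_pos hc)).symm, ?_⟩
    · simp only [Prog.exec, NExp.eval, hlast₂, ht]
    · rw [hret]
      simp only [NExp.cost, IExp.cost]
      omega
  · rw [exec_ifEq_neg fun h => hc (hkt.symm.trans h)]
    refine ⟨Eq.trans ?_ (minCost_last_block (t := t) ht1 (hself t) hc (if_neg hc)).symm, ?_⟩
    · simp only [Prog.exec, NExp.eval, hlast₂, ht]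
    · rw [hret]
      simp only [NExp.cost, IExp.cost]
      omega

end Execution

/-! ### Dominating functions as labels of cliques and cut-vertices -/

section Labelings

variable {V β : Type*} {G : SimpleGraph V}

lemma sum_update_add (S : Finset V) [DecidableEq V] (f : V → ℕ) {w : V} (hw : w ∈ S) (c : ℕ) :
    ∑ v ∈ S, Function.update f w c v + f w = ∑ v ∈ S, f v + c := by
  rw [Finset.sum_update_of_mem hw, ← Finset.add_sum_erase _ _ hw, Finset.sdiff_singleton_eq_erase]
  omega

variable [Fintype V]

open Classical in
/-- The total value of the neighbours of `v`. -/
noncomputable def nbrSum (G : SimpleGraph V) (f : V → ℕ) (v : V) : ℕ :=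
  ∑ u with G.Adj v u, f u

lemma isIndepItalianDominating_iff {f : V → ℕ} :
    IsIndepItalianDominating G f ↔ (∀ v, f v ≤ 2) ∧ (∀ v, f v = 0 → 2 ≤ nbrSum G f v) ∧
      ∀ u v, G.Adj u v → f u = 0 ∨ f v = 0 := by
  have h2 : ∀ v, f v ∈ ({0, 1, 2} : Set ℕ) ↔ f v ≤ 2 := fun v => by
    simp only [Set.mem_insert_iff, Set.mem_singleton_iff]; omega
  unfold IsIndepItalianDominating IsItalianDominating
  simp only [h2]
  rw [and_assoc]
  refine and_congr_right fun hle => and_congr_right fun _ => ?_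
  have hmem : ∀ v, v ∈ ({v | f v = 1} ∪ {v | f v = 2} : Set V) ↔ f v ≠ 0 := fun v => by
    have := hle v
    simp only [Set.mem_union, Set.mem_ofPred_eq]
    omega
  constructor
  · intro h u v huv
    by_contra! hcon
    exact h ((hmem u).2 hcon.1) ((hmem v).2 hcon.2) huv.ne huv
  · intro h u hu v hv _ huv
    rcases h u v huv with h | h
    · exact (hmem u).1 hu h
    · exact (hmem v).1 hv h

lemma le_nbrSum {f : V → ℕ} {v u : V} (h : G.Adj v u) : f u ≤ nbrSum G f v := by
  classical
  exact Finset.single_le_sum (f := f) (fun _ _ => Nat.zero_le _) (by simpa using h)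

lemma add_le_nbrSum {f : V → ℕ} {v u w : V} (hu : G.Adj v u) (hw : G.Adj v w) (h : u ≠ w) :
    f u + f w ≤ nbrSum G f v := by
  classical
  rw [← Finset.sum_pair h]
  refine Finset.sum_le_sum_of_subset ?_
  intro y hy
  simp only [Finset.mem_insert, Finset.mem_singleton] at hy
  rcases hy with rfl | rfl <;> simpa

/-- A value `2` on a vertex with complete neighbourhood can be lowered or moved to a neighbour. -/
lemma exists_lower_of_simplicial {C : V → Prop} [DecidablePred C] {f : V → ℕ}
    (hf : IsIndepItalianDominating G f) {w : V} (hw : f w = 2) (hwC : ¬ C w)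
    (hnbr : ∀ u, G.Adj w u → C u)
    (hclique : ∀ u v, G.Adj w u → G.Adj w v → u ≠ v → G.Adj u v) :
    ∃ g, IsIndepItalianDominating G g ∧ ∑ v, g v ≤ ∑ v, f v ∧
      ∑ v, g v + ∑ v with ¬ C v, g v < ∑ v, f v + ∑ v with ¬ C v, f v := by
  classical
  rw [isIndepItalianDominating_iff] at hf
  obtain ⟨hle, hdom, hind⟩ := hf
  have hnbr0 : ∀ u, G.Adj w u → f u = 0 := fun u hu => (hind w u hu).resolve_left (by omega)
  -- If some neighbour `u` receives nothing besides the `2` from `w`, this `2` moves to `u`: the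
  -- weight is kept and the part outside `C` drops. Otherwise each neighbour of `w` receives at
  -- least `3`, and `1` at `w` suffices.
  by_cases hcase : ∃ u, G.Adj w u ∧ nbrSum G f u ≤ 2
  · obtain ⟨u, hwu, hu2⟩ := hcase
    have hne : u ≠ w := hwu.ne'
    set f' := Function.update f w 0 with hf'
    set g := Function.update f' u 2 with hg
    have hgu : g u = 2 := by simp [hg]
    have hgw : g w = 0 := by simp [hg, hf', hne.symm]
    have hgv : ∀ v, v ≠ u → v ≠ w → g v = f v := fun v h1 h2 => by simp [hg, hf', h1, h2]
    have hf'u : f' u = 0 := by simp [hf', hne, hnbr0 u hwu]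
    have hsum : ∑ v, g v = ∑ v, f v := by
      have h1 := sum_update_add Finset.univ f (Finset.mem_univ w) 0
      have h2 := sum_update_add Finset.univ f' (Finset.mem_univ u) 2
      rw [← hf'] at h1
      rw [← hg] at h2
      omega
    have hpriv : ∑ v with ¬ C v, g v < ∑ v with ¬ C v, f v := by
      have h1 := sum_update_add (Finset.univ.filter fun v => ¬ C v) f (w := w) (by simpa) 0
      have h2 : ∑ v with ¬ C v, g v = ∑ v with ¬ C v, f' v :=
        Finset.sum_update_of_notMem (by simpa using hnbr u hwu) _ _
      rw [← hf'] at h1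
      omega
    refine ⟨g, isIndepItalianDominating_iff.2 ⟨?_, ?_, ?_⟩, hsum.le, by omega⟩
    · intro v
      by_cases h1 : v = u
      · rw [h1, hgu]
      by_cases h2 : v = w
      · rw [h2, hgw]; omega
      rw [hgv v h1 h2]; exact hle v
    · intro v hv
      have h1 : v ≠ u := by rintro rfl; omega
      by_cases hvu : G.Adj v u
      · exact hgu ▸ le_nbrSum (f := g) hvu
      have h2 : v ≠ w := by rintro rfl; exact hvu hwu
      rw [hgv v h1 h2] at hv
      refine (hdom v hv).trans (Finset.sum_le_sum fun y hy => ?_)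
      simp only [Finset.mem_filter, Finset.mem_univ, true_and] at hy
      have hyu : y ≠ u := by rintro rfl; exact hvu hy
      -- A vertex `v ≠ u` adjacent to `w` would be adjacent to `u`, so the vertices not adjacent to
      -- `u` lose nothing.
      have hyw : y ≠ w := by
        rintro rfl; exact hvu (hclique v u hy.symm hwu h1)
      rw [hgv y hyu hyw]
    · have key : ∀ y, G.Adj u y → g y = 0 := by
        intro y hy
        by_cases hyw : y = w
        · rw [hyw, hgw]
        rw [hgv y hy.ne' hyw]
        have := add_le_nbrSum (f := f) hy hwu.symm hyw
        omega
      intro y z hyz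
      by_cases hyu : y = u
      · subst hyu; exact .inr (key z hyz)
      by_cases hzu : z = u
      · subst hzu; exact .inl (key y hyz.symm)
      by_cases hyw : y = w
      · exact .inl (hyw ▸ hgw)
      by_cases hzw : z = w
      · exact .inr (hzw ▸ hgw)
      rw [hgv y hyu hyw, hgv z hzu hzw]
      exact hind y z hyz
  · push Not at hcase
    set g := Function.update f w 1 with hg
    have hgw : g w = 1 := by simp [hg]
    have hgv : ∀ v, v ≠ w → g v = f v := fun v h => by simp [hg, h]
    have hsum : ∑ v, g v + 2 = ∑ v, f v + 1 := by
      have h1 := sum_update_add Finset.univ f (Finset.mem_univ w) 1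
      rwa [hw] at h1
    have hpriv : ∑ v with ¬ C v, g v + 2 = ∑ v with ¬ C v, f v + 1 := by
      have h1 := sum_update_add (Finset.univ.filter fun v => ¬ C v) f (w := w) (by simpa) 1
      rwa [hw] at h1
    refine ⟨g, isIndepItalianDominating_iff.2 ⟨?_, ?_, ?_⟩, by omega, by omega⟩
    · intro v
      by_cases h2 : v = w
      · rw [h2, hgw]; omega
      rw [hgv v h2]; exact hle v
    · intro v hv
      have h1 : v ≠ w := by rintro rfl; omega
      rw [hgv v h1] at hv
      by_cases hvw : G.Adj v w
      · have h2 := hcase v hvw.symm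
        have h3 := sum_update_add (Finset.univ.filter fun u => G.Adj v u) f (w := w)
          (by simpa) 1
        rw [hw] at h3
        change nbrSum G g v + 2 = nbrSum G f v + 1 at h3
        omega
      · have h3 : nbrSum G g v = nbrSum G f v := Finset.sum_update_of_notMem (by simpa) _ _
        rw [h3]
        exact hdom v hv
    · intro y z hyz
      by_cases hyw : y = w
      · subst hyw
        rw [hgv z hyz.ne']
        exact .inr (hnbr0 z hyz)
      by_cases hzw : z = w
      · subst hzw
        rw [hgv y hyw]
        exact .inl (hnbr0 y hyz.symm)
      rw [hgv y hyw, hgv z hzw]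
      exact hind y z hyz

/-- The sets `M B` are cliques which cover `G` edge-disjointly, and a vertex outside `C` lies in
only one of them. -/
structure CliqueCover (G : SimpleGraph V) (M : β → V → Prop) (C : V → Prop) : Prop where
  adj_iff : ∀ u v, G.Adj u v ↔ u ≠ v ∧ ∃ B, M B u ∧ M B v
  exists_mem : ∀ v, ∃ B, M B v
  eq_of_mem : ∀ v B D, ¬ C v → M B v → M D v → B = D
  eq_of_mem_of_mem : ∀ u v B D, u ≠ v → M B u → M B v → M D u → M D v → B = D

variable {M : β → V → Prop} {C : V → Prop}

open Classical in
/-- The total value of a clique. -/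
noncomputable def blockSum (M : β → V → Prop) (f : V → ℕ) (B : β) : ℕ :=
  ∑ v with M B v, f v

open Classical in
/-- The vertices of a clique that lie in no other clique. -/
noncomputable def privateVertices (M : β → V → Prop) (C : V → Prop) (B : β) : Finset V :=
  Finset.univ.filter fun v => M B v ∧ ¬ C v

/-- The type of a clique. -/
noncomputable def cliqueType (M : β → V → Prop) (C : V → Prop) (B : β) : ℕ :=
  if (privateVertices M C B).card = 0 then 0
  else if (privateVertices M C B).card = 1 then 1 else 2

lemma mem_privateVertices {B : β} {v : V} : v ∈ privateVertices M C B ↔ M B v ∧ ¬ C v := by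
  simp [privateVertices]

open Classical in
lemma blockSum_eq (f : V → ℕ) (B : β) :
    blockSum M f B = ∑ v ∈ privateVertices M C B, f v + ∑ v with C v ∧ M B v, f v := by
  unfold blockSum privateVertices
  rw [← Finset.sum_filter_add_sum_filter_not _ (fun v => ¬ C v), Finset.filter_filter,
    Finset.filter_filter]
  congr 2
  ext v
  simp
  tauto

lemma add_le_blockSum {f : V → ℕ} {B : β} {u v : V} (hu : M B u) (hv : M B v) (h : u ≠ v) :
    f u + f v ≤ blockSum M f B := by
  classical
  rw [← Finset.sum_pair h]
  refine Finset.sum_le_sum_of_subset ?_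
  intro y hy
  simp only [Finset.mem_insert, Finset.mem_singleton] at hy
  rcases hy with rfl | rfl <;> simpa

variable [Fintype β]

open Classical in
-- Two cliques through `v` meet only in `v`, so the neighbours of `v` split among them; `f v = 0`
-- allows `v` itself to be counted in each.
lemma CliqueCover.nbrSum_eq (h : CliqueCover G M C) {f : V → ℕ} {v : V} (hv : f v = 0) :
    nbrSum G f v = ∑ B with M B v, blockSum M f B := by
  have h1 : ∀ B ∈ Finset.univ.filter (fun B => M B v), blockSum M f B =
      ∑ u with M B u ∧ u ≠ v, f u := by
    intro B hB
    unfold blockSum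
    rw [← Finset.filter_filter, Finset.filter_ne', Finset.sum_erase _ hv]
  rw [Finset.sum_congr rfl h1, ← Finset.sum_biUnion]
  · unfold nbrSum
    congr 1
    ext u
    simp only [Finset.mem_filter, Finset.mem_univ, true_and, Finset.mem_biUnion, h.adj_iff]
    constructor
    · rintro ⟨hne, B, hBv, hBu⟩
      exact ⟨B, hBv, hBu, hne.symm⟩
    · rintro ⟨B, hBv, hBu, hne⟩
      exact ⟨hne.symm, B, hBv, hBu⟩
  · intro B hB D hD hne
    simp only [Finset.coe_filter, Finset.mem_univ, true_and, Set.mem_ofPred_eq] at hB hD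
    refine Finset.disjoint_left.2 fun u hu hu' => hne ?_
    simp only [Finset.mem_filter, Finset.mem_univ, true_and] at hu hu'
    exact h.eq_of_mem_of_mem u v B D hu.2 hu.1 hB hu'.1 hD

lemma CliqueCover.nbrSum_eq_of_not (h : CliqueCover G M C) {f : V → ℕ} {v : V} (hv : f v = 0)
    (hC : ¬ C v) {B : β} (hB : M B v) : nbrSum G f v = blockSum M f B := by
  classical
  rw [h.nbrSum_eq hv, show (Finset.univ.filter fun D => M D v) = {B} from ?_]
  · simp
  · ext D
    simp only [Finset.mem_filter, Finset.mem_univ, true_and, Finset.mem_singleton]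
    exact ⟨fun hD => h.eq_of_mem v D B hC hD hB, fun hD => hD ▸ hB⟩

open Classical in
lemma CliqueCover.sum_eq (h : CliqueCover G M C) (f : V → ℕ) :
    ∑ v, f v = ∑ v with C v, f v + ∑ B, ∑ v ∈ privateVertices M C B, f v := by
  rw [← Finset.sum_filter_add_sum_filter_not _ C, ← Finset.sum_biUnion]
  · congr 2
    ext v
    obtain ⟨B, hB⟩ := h.exists_mem v
    simp only [Finset.mem_filter, Finset.mem_univ, true_and, Finset.mem_biUnion,
      mem_privateVertices]
    exact ⟨fun hv => ⟨B, hB, hv⟩, fun ⟨_, _, hv⟩ => hv⟩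
  · intro B _ D _ hne
    refine Finset.disjoint_left.2 fun u hu hu' => hne ?_
    rw [mem_privateVertices] at hu hu'
    exact h.eq_of_mem u B D hu.2 hu.1 hu'.1

/-- Every independent Italian dominating function can be replaced by one, of at most the same
weight, without value `2` on the only private vertex of a clique. -/
lemma CliqueCover.exists_reduced (h : CliqueCover G M C) {f : V → ℕ}
    (hf : IsIndepItalianDominating G f) :
    ∃ g, IsIndepItalianDominating G g ∧ ∑ v, g v ≤ ∑ v, f v ∧
      ∀ B w, privateVertices M C B = {w} → g w ≠ 2 := by
  classical
  -- The measure counts vertices outside `C` twice, so both lowering and moving a value decrease it.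
  induction hm : ∑ v, f v + ∑ v with ¬ C v, f v using Nat.strong_induction_on generalizing f with
  | _ m ih =>
  by_cases hgood : ∀ B w, privateVertices M C B = {w} → f w ≠ 2
  · exact ⟨f, hf, le_rfl, hgood⟩
  push Not at hgood
  obtain ⟨B, w, hBw, hw⟩ := hgood
  obtain ⟨hMw, hCw⟩ := mem_privateVertices.1 (hBw ▸ Finset.mem_singleton_self w)
  have hnbr : ∀ u, G.Adj w u → M B u := by
    intro u hu
    obtain ⟨hne, D, hDw, hDu⟩ := (h.adj_iff w u).1 hu
    rwa [h.eq_of_mem w B D hCw hMw hDw]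
  obtain ⟨g, hg, hle, hlt⟩ := exists_lower_of_simplicial (C := C) hf hw hCw (fun u hu => by
    by_contra hCu
    have := mem_privateVertices.2 ⟨hnbr u hu, hCu⟩
    rw [hBw, Finset.mem_singleton] at this
    exact hu.ne' this) (fun u v hu hv hne => (h.adj_iff u v).2 ⟨hne, B, hnbr u hu, hnbr v hv⟩)
  obtain ⟨g', h1, h2, h3⟩ := ih _ (hm ▸ hlt) hg rfl
  exact ⟨g', h1, h2.trans hle, h3⟩

/-- Consistent labels of the cliques and of the vertices in `C`. -/
structure ConsistentLabels (M : β → V → Prop) (C : V → Prop) (x a : V → ℕ) (F s : β → ℕ) :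
    Prop where
  cut : ∀ v, C v → x v = 0 → open Classical in 2 ≤ a v + ∑ B with M B v, F B
  block : ∀ B, open Classical in F B = s B + ∑ v with C v ∧ M B v, x v
  choice : ∀ B v, C v → M B v → x v = 0 ∨ x v = F B

open Classical in
/-- The initial cost of labels. -/
noncomputable def labelCost (M : β → V → Prop) (C : V → Prop) (x a : V → ℕ) (F s : β → ℕ) : ℕ∞ :=
  ∑ v with C v, initCost 3 (x v) (a v) + ∑ B, initCost (cliqueType M C B) (F B) (s B)

/-- The labels are read off a reduced function; the guarantees are `0` because no clique has been
eliminated yet. -/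
lemma CliqueCover.exists_labels (h : CliqueCover G M C) {f : V → ℕ}
    (hf : IsIndepItalianDominating G f) :
    ∃ x a F s, ConsistentLabels M C x a F s ∧ labelCost M C x a F s ≤ (∑ v, f v : ℕ) := by
  classical
  obtain ⟨g, hg, hle, hred⟩ := h.exists_reduced hf
  obtain ⟨hle2, hdom, hind⟩ := isIndepItalianDominating_iff.1 hg
  -- By independence a clique has at most one nonzero vertex, so a sum over part of it is that value
  -- or `0`.
  have hone : ∀ B v, M B v → g v ≠ 0 → ∀ S : Finset V, (∀ u ∈ S, M B u) →
      ∑ u ∈ S, g u = if v ∈ S then g v else 0 := by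
    intro B v hv hne S hS
    have hzero : ∀ u ∈ S, u ≠ v → g u = 0 := fun u hu huv =>
      (hind u v ((h.adj_iff u v).2 ⟨huv, B, hS u hu, hv⟩)).resolve_right hne
    split_ifs with hvS
    · exact Finset.sum_eq_single v hzero fun hvS' => absurd hvS hvS'
    · exact Finset.sum_eq_zero fun u hu => hzero u hu fun huv => hvS (huv ▸ hu)
  have hone' : ∀ B v, M B v → g v ≠ 0 → blockSum M g B = g v := by
    intro B v hv hne
    unfold blockSum
    rw [hone B v hv hne _ (by simp), if_pos (by simpa using hv)]
  have hF : ∀ B, blockSum M g B ≤ 2 ∧ (∑ v ∈ privateVertices M C B, g v = 0 ∨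
      ∑ v ∈ privateVertices M C B, g v = blockSum M g B) := by
    intro B
    by_cases hex : ∃ v, M B v ∧ g v ≠ 0
    · obtain ⟨v, hv, hne⟩ := hex
      rw [hone' B v hv hne, hone B v hv hne _ fun u hu => (mem_privateVertices.1 hu).1]
      exact ⟨hle2 v, by split_ifs <;> simp⟩
    · push Not at hex
      have h0 : blockSum M g B = 0 := Finset.sum_eq_zero fun v hv => hex v (by simpa using hv)
      rw [h0]
      refine ⟨by omega, .inl (Finset.sum_eq_zero fun v hv => hex v (mem_privateVertices.1 hv).1)⟩
  refine ⟨g, fun _ => 0, blockSum M g, fun B => ∑ v ∈ privateVertices M C B, g v,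
    ⟨fun v _ hv0 => ?_, fun B => blockSum_eq g B, fun B v _ hv => ?_⟩, ?_⟩
  · rw [zero_add, ← h.nbrSum_eq hv0]
    exact hdom v hv0
  · by_cases hne : g v = 0
    · exact .inl hne
    · exact .inr (hone' B v hv hne).symm
  · refine le_trans ?_ (Nat.cast_le.2 hle)
    rw [h.sum_eq g, labelCost]
    push_cast
    gcongr with v hv B
    · have := hle2 v
      obtain h0 | h0 | h0 : g v = 0 ∨ g v = 1 ∨ g v = 2 := by omega
      all_goals simp [h0, initCost, cutCost]
    · rw [← Nat.cast_sum]
      obtain ⟨h1, h2⟩ := hF B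
      set F := blockSum M g B with hFdef
      set s := ∑ v ∈ privateVertices M C B, g v with hs
      -- A private vertex of value `0` receives from its own clique only. This is the source of the
      -- infinite entries with total below `2`.
      have hzero : ∀ w ∈ privateVertices M C B, g w = 0 → F = 2 := by
        intro w hw hw0
        obtain ⟨hMw, hCw⟩ := mem_privateVertices.1 hw
        have := hdom w hw0
        rw [h.nbrSum_eq_of_not hw0 hCw hMw] at this
        omega
      unfold cliqueType
      split_ifs with hk hk
      · have hs0 : s = 0 := by rw [hs, Finset.card_eq_zero.1 hk]; rfl
        rw [hs0]
        obtain h0 | h0 | h0 : F = 0 ∨ F = 1 ∨ F = 2 := by omega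
        · simp [h0, initCost, blockCost]
        · simp [h0, initCost, blockCost]
        · simp [h0, initCost, blockCost]
      · obtain ⟨w, hw⟩ := Finset.card_eq_one.1 hk
        have hsw : s = g w := by rw [hs, hw, Finset.sum_singleton]
        -- Here the reduction is indispensable: the initial table of type `1` has `∞` at `(2, 2)`.
        have hw2 := hred B w hw
        have := hle2 w
        have hw' : w ∈ privateVertices M C B := hw ▸ Finset.mem_singleton_self w
        obtain h0 | h0 : g w = 0 ∨ g w = 1 := by omega
        · rw [hsw, h0, hzero w hw' h0]
          simp [initCost, blockCost]
        · rw [hsw, h0, show F = 1 by omega]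
          simp [initCost, blockCost]
      · have hF2 : F = 2 := by
          obtain ⟨u, hu, w, hw, hne⟩ := Finset.one_lt_card.1
            (show 1 < (privateVertices M C B).card by omega)
          rcases hind u w ((h.adj_iff u w).2 ⟨hne, B, (mem_privateVertices.1 hu).1,
            (mem_privateVertices.1 hw).1⟩) with h0 | h0
          · exact hzero u hu h0
          · exact hzero w hw h0
        rw [hF2]
        obtain h0 | h0 : s = 0 ∨ s = 2 := by omega
        all_goals simp [h0, initCost, blockCost]

lemma initCost_cut_ne_top {x a : ℕ} (h : initCost 3 x a ≠ ⊤) :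
    x ≤ 2 ∧ initCost 3 x a = x ∧ (x = 0 → a = 0) := by
  simp only [initCost, if_true] at *
  unfold cutCost at *
  split <;> simp_all

/-- The last two implications are what dominates the private vertices of value `0`. -/
lemma initCost_block_ne_top {k F s : ℕ} (hk : k ≤ 2) (h : initCost k F s ≠ ⊤) :
    F ≤ 2 ∧ initCost k F s = s ∧ (s = 0 ∨ s = F) ∧ (k = 0 → s = 0) ∧ (k = 1 → s = 0 → F = 2) ∧
      (k = 2 → F = 2) := by
  have hF : F ≤ 2 := by
    by_contra hF
    apply h
    unfold initCost
    split_ifs with h1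
    · omega
    all_goals exact blockCost_eq_top (.inl (by omega))
  have hs : s = 0 ∨ s = F := by
    by_contra hs
    apply h
    unfold initCost
    split_ifs with h1
    · omega
    all_goals exact blockCost_eq_top (.inr (by omega))
  interval_cases k <;> interval_cases F <;> rcases hs with rfl | rfl <;>
    simp_all [initCost, blockCost]

lemma sum_eq_top_of_mem {ι : Type*} {S : Finset ι} {g : ι → ℕ∞} {i : ι} (hi : i ∈ S)
    (h : g i = ⊤) : ∑ i ∈ S, g i = ⊤ :=
  top_le_iff.1 (h ▸ Finset.single_le_sum (fun _ _ => zero_le) hi)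

/-- The share `s B` goes to one representative private vertex of `B`, and the other private vertices
get `0`. Without private vertices the type is `0`, and finite cost forces `s B = 0`. -/
lemma CliqueCover.exists_of_labels (h : CliqueCover G M C) {x a : V → ℕ} {F s : β → ℕ}
    (hc : ConsistentLabels M C x a F s) (hcost : labelCost M C x a F s ≠ ⊤) :
    ∃ f, IsIndepItalianDominating G f ∧ (∑ v, f v : ℕ) = labelCost M C x a F s := by
  classical
  unfold labelCost at hcost
  have hcutne : ∀ v, C v → initCost 3 (x v) (a v) ≠ ⊤ := by
    intro v hv htop
    apply hcost
    rw [sum_eq_top_of_mem (g := fun v => initCost 3 (x v) (a v)) (i := v) (by simpa using hv) htop, top_add]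
  have hblockne : ∀ B, initCost (cliqueType M C B) (F B) (s B) ≠ ⊤ := by
    intro B htop
    apply hcost
    rw [sum_eq_top_of_mem (g := fun B => initCost (cliqueType M C B) (F B) (s B))
      (Finset.mem_univ B) htop, add_top]
  have htype : ∀ B, cliqueType M C B ≤ 2 := fun B => by unfold cliqueType; split_ifs <;> omega
  have hcut := fun v hv => initCost_cut_ne_top (hcutne v hv)
  have hblock := fun B => initCost_block_ne_top (htype B) (hblockne B)
  choose b hb using h.exists_mem
  have hbeq : ∀ v B, ¬ C v → M B v → b v = B := fun v B hv hB =>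
    h.eq_of_mem v _ _ hv (hb v) hB
  have hr : ∀ B, ∃ r : Option V, ∀ v, (r = some v → v ∈ privateVertices M C B) ∧
      (r = none → v ∉ privateVertices M C B) := by
    intro B
    rcases (privateVertices M C B).eq_empty_or_nonempty with he | ⟨w, hw⟩
    · exact ⟨none, fun v => by simp [he]⟩
    · exact ⟨some w, fun v => by simp; rintro rfl; exact hw⟩
  choose r hr using hr
  let f : V → ℕ := fun v => if C v then x v else if r (b v) = some v then s (b v) else 0
  have hfC : ∀ v, C v → f v = x v := fun v hv => if_pos hv
  have hfB : ∀ v B, ¬ C v → M B v → f v = if r B = some v then s B else 0 := by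
    intro v B hv hB
    have := hbeq v B hv hB
    simp only [f, if_neg hv, this]
  have hpriv : ∀ B, ∑ v ∈ privateVertices M C B, f v = s B := by
    intro B
    rw [Finset.sum_congr rfl fun v hv =>
      hfB v B (mem_privateVertices.1 hv).2 (mem_privateVertices.1 hv).1]
    cases hrB : r B with
    | none =>
      have he : privateVertices M C B = ∅ :=
        Finset.eq_empty_of_forall_notMem fun v => (hr B v).2 hrB
      rw [he, Finset.sum_empty]
      refine ((hblock B).2.2.2.1 ?_).symm
      simp [cliqueType, he]
    | some w =>
      have hw := (hr B w).1 hrB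
      rw [Finset.sum_eq_single w]
      · simp
      · intro v _ hvw
        rw [if_neg]
        simpa using hvw.symm
      · exact fun h => absurd hw h
  have hsum : ∀ B, blockSum M f B = F B := by
    intro B
    rw [blockSum_eq (C := C), hpriv, hc.block B]
    congr 1
    refine Finset.sum_congr rfl fun v hv => hfC v ?_
    simp only [Finset.mem_filter] at hv
    exact hv.2.1
  have hchoice : ∀ B v, M B v → f v = 0 ∨ f v = F B := by
    intro B v hv
    by_cases hCv : C v
    · rw [hfC v hCv]
      exact hc.choice B v hCv hv
    · rw [hfB v B hCv hv]
      split_ifs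
      · exact (hblock B).2.2.1
      · exact .inl rfl
  refine ⟨f, isIndepItalianDominating_iff.2 ⟨?_, ?_, ?_⟩, ?_⟩
  · intro v
    have h1 := hchoice (b v) v (hb v)
    have h2 := (hblock (b v)).1
    omega
  · intro v hv
    by_cases hCv : C v
    · rw [h.nbrSum_eq hv]
      simp only [hsum]
      rw [hfC v hCv] at hv
      have h1 := hc.cut v hCv hv
      rwa [(hcut v hCv).2.2 hv, zero_add] at h1
    · rw [h.nbrSum_eq_of_not hv hCv (hb v), hsum]
      have hvp := mem_privateVertices.2 ⟨hb v, hCv⟩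
      obtain ⟨-, -, -, -, h1, h2⟩ := hblock (b v)
      unfold cliqueType at h1 h2
      have hk : (privateVertices M C (b v)).card ≠ 0 := Finset.card_ne_zero_of_mem hvp
      rw [if_neg hk] at h1 h2
      split_ifs at h1 h2 with hk1
      · refine (h1 rfl ?_).ge
        obtain ⟨w, hw⟩ := Finset.card_eq_one.1 hk1
        rw [hw, Finset.mem_singleton] at hvp
        rw [← hpriv, hw, Finset.sum_singleton, ← hvp, hv]
      · exact (h2 rfl).ge
  · intro u v huv
    obtain ⟨hne, B, hu, hv⟩ := (h.adj_iff u v).1 huv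
    have h1 := hchoice B u hu
    have h2 := hchoice B v hv
    -- Both values are `0` or `F B` and their sum is at most `F B`, so one of them vanishes.
    have h3 := add_le_blockSum (f := f) hu hv hne
    rw [hsum] at h3
    omega
  · rw [h.sum_eq f, labelCost]
    push_cast
    congr 1
    · refine Finset.sum_congr rfl fun v hv => ?_
      simp only [Finset.mem_filter, Finset.mem_univ, true_and] at hv
      rw [(hcut v hv).2.1, hfC v hv]
    · refine Finset.sum_congr rfl fun B _ => ?_
      rw [(hblock B).2.1, ← hpriv B, Nat.cast_sum]

end Labelings

/-! ### The block-cutpoint graph as a labelled tree -/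

section BlockCutTree

variable {V : Type*} {G : SimpleGraph V} {n : ℕ} {ord : Fin n ≃ BCVertex G}

lemma IsTreeOrder.exists_unique_parent_of_lt {W : Type*} {T : SimpleGraph W} {ord : Fin n ≃ W}
    (h : IsTreeOrder T ord) {i j k : Fin n} (hij : i < j) (hik : i < k)
    (hj : T.Adj (ord i) (ord j)) (hk : T.Adj (ord i) (ord k)) : j = k :=
  (h i (by have : (i : ℕ) < j := hij; omega)).unique ⟨hij, hj⟩ ⟨hik, hk⟩

/-- The earliest vertex of a four-cycle would have two later neighbours. -/
lemma IsTreeOrder.not_four_cycle {W : Type*} {T : SimpleGraph W} {ord : Fin n ≃ W}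
    (h : IsTreeOrder T ord) {a b c d : W} (hab : T.Adj a b) (hbc : T.Adj b c) (hcd : T.Adj c d)
    (hda : T.Adj d a) (hac : a ≠ c) (hbd : b ≠ d) : False := by
  obtain ⟨a, rfl⟩ := ord.surjective a
  obtain ⟨b, rfl⟩ := ord.surjective b
  obtain ⟨c, rfl⟩ := ord.surjective c
  obtain ⟨d, rfl⟩ := ord.surjective d
  have hac' : a ≠ c := fun e => hac (e ▸ rfl)
  have hbd' : b ≠ d := fun e => hbd (e ▸ rfl)
  have nab : a ≠ b := fun e => hab.ne (e ▸ rfl)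
  have nbc : b ≠ c := fun e => hbc.ne (e ▸ rfl)
  have ncd : c ≠ d := fun e => hcd.ne (e ▸ rfl)
  have nda : d ≠ a := fun e => hda.ne (e ▸ rfl)
  have ha : ¬ (a < b ∧ a < d) := fun hlt =>
    hbd' (h.exists_unique_parent_of_lt hlt.1 hlt.2 hab hda.symm)
  have hb : ¬ (b < a ∧ b < c) := fun hlt =>
    hac' (h.exists_unique_parent_of_lt hlt.1 hlt.2 hab.symm hbc)
  have hc : ¬ (c < b ∧ c < d) := fun hlt =>
    hbd' (h.exists_unique_parent_of_lt hlt.1 hlt.2 hbc.symm hcd)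
  have hd : ¬ (d < a ∧ d < c) := fun hlt =>
    hac' (h.exists_unique_parent_of_lt hlt.1 hlt.2 hda hcd.symm)
  omega

/-- Membership of a vertex in a block. -/
abbrev BlockMem (G : SimpleGraph V) (B : {B : G.Subgraph // IsBlock G B}) (v : V) : Prop :=
  v ∈ B.1.verts

lemma restSum_inl [Fintype {B : G.Subgraph // IsBlock G B}]
    {F : {B : G.Subgraph // IsBlock G B} → ℕ} {p : Fin n → ℕ} (hF : ∀ B, p (ord.symm (.inr B)) = F B) (v : {v : V // IsCutVertex G v}) :
    restSum (fun i k => (blockCutGraph G).Adj (ord i) (ord k)) 0 p (ord.symm (.inl v)) =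
      open Classical in ∑ B with BlockMem G B v.1, F B := by
  classical
  unfold restSum
  symm
  refine Finset.sum_bij (fun B _ => ord.symm (.inr B)) ?_ ?_ ?_ ?_
  · intro B hB
    simp only [Finset.mem_filter, Finset.mem_univ, true_and] at hB ⊢
    simp only [Equiv.apply_symm_apply, Nat.zero_le, true_and]
    exact hB
  · intro B _ D _ h
    simpa using h
  · intro k hk
    simp only [Finset.mem_filter, Finset.mem_univ, true_and, Equiv.apply_symm_apply] at hk
    obtain ⟨w, rfl⟩ := ord.symm.surjective k
    rw [Equiv.apply_symm_apply] at hk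
    rcases w with w | B
    · exact absurd hk.2 (by simp [blockCutGraph])
    · exact ⟨B, Finset.mem_filter.2 ⟨Finset.mem_univ B, hk.2⟩, rfl⟩
  · intro B _
    exact (hF B).symm

variable [Fintype V]

/-- Two common vertices of distinct blocks would both be cut-vertices, and with the blocks they
would form a four-cycle of the block-cutpoint graph. -/
lemma cliqueCover_blocks (hG : IsBlockGraph G) (hT : IsTreeOrder (blockCutGraph G) ord) :
    CliqueCover G (BlockMem G) (IsCutVertex G) where
  adj_iff u v := by
    constructor
    · intro h
      obtain ⟨B, hB, hu, hv⟩ := exists_isBlock_of_adj h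
      exact ⟨h.ne, ⟨B, hB⟩, hu, hv⟩
    · rintro ⟨hne, ⟨B, hB⟩, hu, hv⟩
      exact hB.adj hG hu hv hne
  exists_mem v := by
    obtain ⟨B, hB, hv⟩ := exists_isBlock_mem (G := G) v
    exact ⟨⟨B, hB⟩, hv⟩
  eq_of_mem v B D hv hB hD := Subtype.ext (B.2.eq_of_mem hG D.2 hv hB hD)
  eq_of_mem_of_mem u v B D hne huB hvB huD hvD := by
    by_contra hBD
    have hu : IsCutVertex G u := by
      by_contra hu
      exact hBD (Subtype.ext (B.2.eq_of_mem hG D.2 hu huB huD))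
    have hv : IsCutVertex G v := by
      by_contra hv
      exact hBD (Subtype.ext (B.2.eq_of_mem hG D.2 hv hvB hvD))
    exact hT.not_four_cycle (a := .inl ⟨u, hu⟩) (b := .inr B) (c := .inl ⟨v, hv⟩) (d := .inr D)
      huB hvB hvD huD (by simpa using hne) (by simpa using hBD)

lemma blockType_eq_cliqueType (B : {B : G.Subgraph // IsBlock G B}) :
    blockType G B.1 = cliqueType (BlockMem G) (IsCutVertex G) B := by
  classical
  have h1 : (privateVertices (BlockMem G) (IsCutVertex G) B).card =
      {v ∈ B.1.verts | ¬ IsCutVertex G v}.ncard := by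
    rw [← Set.ncard_coe_finset]
    congr 1
    ext v
    simp [mem_privateVertices]
  have h2 : B.1.verts.ncard = {v ∈ B.1.verts | IsCutVertex G v}.ncard +
      {v ∈ B.1.verts | ¬ IsCutVertex G v}.ncard := by
    rw [← Set.ncard_union_eq]
    · congr 1
      ext v
      simp only [Set.mem_union, Set.mem_ofPred_eq]
      tauto
    · exact Set.disjoint_left.2 fun v hv hv' => hv'.2 hv.2
  unfold blockType cliqueType
  rw [h1, h2]
  congr 1
  · simp
  · congr 1
    simp

lemma cliqueType_le_two {β : Type*} {M : β → V → Prop} {C : V → Prop} (B : β) :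
    cliqueType M C B ≤ 2 := by
  unfold cliqueType; split_ifs <;> omega

lemma kindCode_inr (B : {B : G.Subgraph // IsBlock G B}) :
    kindCode G (.inr B) = cliqueType (BlockMem G) (IsCutVertex G) B :=
  blockType_eq_cliqueType B

lemma kindCode_inr_ne (B : {B : G.Subgraph // IsBlock G B}) : kindCode G (.inr B) ≠ 3 := by
  rw [kindCode_inr]
  have := cliqueType_le_two (M := BlockMem G) (C := IsCutVertex G) B
  omega

section Transport

variable {x a : V → ℕ}
  {F s : {B : G.Subgraph // IsBlock G B} → ℕ} {p q : Fin n → ℕ}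

lemma restSum_inr (hx : ∀ v, p (ord.symm (.inl v)) = x v.1)
    (B : {B : G.Subgraph // IsBlock G B}) :
    restSum (fun i k => (blockCutGraph G).Adj (ord i) (ord k)) 0 p (ord.symm (.inr B)) =
      open Classical in ∑ v with IsCutVertex G v ∧ BlockMem G B v, x v := by
  classical
  unfold restSum
  symm
  refine Finset.sum_bij (fun v hv => ord.symm (.inl ⟨v, (Finset.mem_filter.1 hv).2.1⟩))
    ?_ ?_ ?_ ?_
  · intro v hv
    simp only [Finset.mem_filter, Finset.mem_univ, true_and] at hv ⊢
    simp only [Equiv.apply_symm_apply, Nat.zero_le, true_and]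
    exact hv.2
  · intro v _ w _ h
    simpa using h
  · intro k hk
    simp only [Finset.mem_filter, Finset.mem_univ, true_and, Equiv.apply_symm_apply] at hk
    obtain ⟨w, rfl⟩ := ord.symm.surjective k
    rw [Equiv.apply_symm_apply] at hk
    rcases w with v | D
    · exact ⟨v.1, by simpa using ⟨v.2, hk.2⟩, rfl⟩
    · exact absurd hk.2 (by simp [blockCutGraph])
  · intro v hv
    exact (hx ⟨v, (Finset.mem_filter.1 hv).2.1⟩).symm

variable [Fintype {B : G.Subgraph // IsBlock G B}]

/-- The labels are linked by equations rather than by a definition, so that either family can be the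
given one. -/
lemma consistent_iff_labels (hx : ∀ v, p (ord.symm (.inl v)) = x v.1)
    (hF : ∀ B, p (ord.symm (.inr B)) = F B) (ha : ∀ v, q (ord.symm (.inl v)) = a v.1)
    (hs : ∀ B, q (ord.symm (.inr B)) = s B) :
    Consistent (fun i k => (blockCutGraph G).Adj (ord i) (ord k))
      (fun i => kindCode G (ord i) = 3) 0 p q ↔
      ConsistentLabels (BlockMem G) (IsCutVertex G) x a F s := by
  constructor
  · intro h
    refine ⟨fun v hv hv0 => ?_, fun B => ?_, fun B v hv hvB => ?_⟩
    · have := (h (ord.symm (.inl ⟨v, hv⟩)) (Nat.zero_le _)).1 (by simp [kindCode])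
        ((hx _).trans hv0)
      rwa [restSum_inl hF, ha] at this
    · have := ((h (ord.symm (.inr B)) (Nat.zero_le _)).2
        (by beta_reduce; rw [Equiv.apply_symm_apply]; exact kindCode_inr_ne B)).1
      rwa [restSum_inr hx, hs, hF] at this
    · have := ((h (ord.symm (.inr B)) (Nat.zero_le _)).2
        (by beta_reduce; rw [Equiv.apply_symm_apply]; exact kindCode_inr_ne B)).2
          (ord.symm (.inl ⟨v, hv⟩)) (Nat.zero_le _) (by
            beta_reduce; rw [Equiv.apply_symm_apply, Equiv.apply_symm_apply]; exact hvB)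
      rwa [hx, hF] at this
  · intro h i _
    obtain ⟨w, rfl⟩ := ord.symm.surjective i
    beta_reduce
    rw [Equiv.apply_symm_apply]
    rcases w with v | B
    · refine ⟨fun _ h0 => ?_, fun h3 => absurd rfl h3⟩
      rw [restSum_inl hF, ha]
      exact h.cut v.1 v.2 ((hx v).symm.trans h0)
    · refine ⟨fun h3 => absurd h3 (kindCode_inr_ne B), fun _ => ⟨?_, fun k _ hk => ?_⟩⟩
      · rw [restSum_inr hx, hs, hF]
        exact h.block B
      · obtain ⟨w, rfl⟩ := ord.symm.surjective k
        rw [Equiv.apply_symm_apply] at hk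
        rcases w with v | D
        · rw [hx, hF]
          exact h.choice B v.1 v.2 hk
        · exact absurd hk (by simp [blockCutGraph])

lemma totalCost_eq_labelCost (hx : ∀ v, p (ord.symm (.inl v)) = x v.1)
    (hF : ∀ B, p (ord.symm (.inr B)) = F B) (ha : ∀ v, q (ord.symm (.inl v)) = a v.1)
    (hs : ∀ B, q (ord.symm (.inr B)) = s B) :
    totalCost (fun i => initCost (kindCode G (ord i))) 0 p q =
      labelCost (BlockMem G) (IsCutVertex G) x a F s := by
  classical
  unfold totalCost labelCost
  rw [Finset.filter_true_of_mem (by simp), ← Equiv.sum_comp ord.symm, Fintype.sum_sum_type]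
  congr 1
  · simp only [Equiv.apply_symm_apply, hx, ha, kindCode]
    exact Finset.sum_subtype_eq_sum_filter (s := Finset.univ)
      (f := fun v => initCost 3 (x v) (a v)) (p := IsCutVertex G) |>.symm ▸ by simp
  · simp only [Equiv.apply_symm_apply, hF, hs, kindCode_inr]

end Transport

lemma exists_isIndepItalianDominating (G : SimpleGraph V) :
    ∃ f, IsIndepItalianDominating G f := by
  classical
  obtain ⟨S, -, hS⟩ := Finite.exists_le_maximal (p := fun S : Set V => G.IsIndepSet S)
    (a := ∅) (by simp [SimpleGraph.IsIndepSet])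
  refine ⟨fun v => if v ∈ S then 2 else 0, isIndepItalianDominating_iff.2 ⟨?_, ?_, ?_⟩⟩
  · intro v
    split_ifs <;> omega
  · intro v hv
    have hvS : v ∉ S := fun h => by simp [h] at hv
    obtain ⟨u, huS, hvu⟩ : ∃ u ∈ S, G.Adj v u := by
      by_contra! hcon
      apply hvS
      refine hS.2 (y := insert v S) ?_ (Set.subset_insert v S) (Set.mem_insert v S)
      rintro y (rfl | hy) z (rfl | hz) hne hyz
      · exact hne rfl
      · exact hcon z hz hyz
      · exact hcon y hy hyz.symm
      · exact hS.1 hy hz hne hyz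
    refine le_trans ?_ (le_nbrSum (f := fun v => if v ∈ S then 2 else 0) hvu)
    simp [huS]
  · intro u v huv
    by_contra! hcon
    have hu : u ∈ S := by by_contra h; simp [h] at hcon
    have hv : v ∈ S := by by_contra h; simp [h] at hcon
    exact hS.1 hu hv huv.ne huv

/-- The least cost of consistent labels of the block-cutpoint graph is the independent Italian
domination number. -/
theorem minCost_eq_indepItalianNumber (hG : IsBlockGraph G)
    (hT : IsTreeOrder (blockCutGraph G) ord) :
    minCost (fun i k => (blockCutGraph G).Adj (ord i) (ord k)) (fun i => kindCode G (ord i) = 3)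
      (fun i => initCost (kindCode G (ord i))) 0 = indepItalianNumber G := by
  classical
  have : Fintype {B : G.Subgraph // IsBlock G B} := Fintype.ofFinite _
  have hcover := cliqueCover_blocks hG hT
  apply le_antisymm
  · obtain ⟨f, hf, hw⟩ : indepItalianNumber G ∈
        {w | ∃ f : V → ℕ, IsIndepItalianDominating G f ∧ w = ∑ v, f v} := by
      obtain ⟨f, hf⟩ := exists_isIndepItalianDominating G
      exact Nat.sInf_mem ⟨_, f, hf, rfl⟩
    obtain ⟨x, a, F, s, hc, hle⟩ := hcover.exists_labels hf
    rw [hw]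
    refine le_trans (iInf_le_of_le (fun i => Sum.elim (fun v => x v.1) F (ord i))
      (iInf_le_of_le (fun i => Sum.elim (fun v => a v.1) s (ord i)) (iInf_le_of_le
        ((consistent_iff_labels (x := x) (a := a) (F := F) (s := s) ?_ ?_ ?_ ?_).2 hc)
        (totalCost_eq_labelCost (x := x) (a := a) (F := F) (s := s) ?_ ?_ ?_ ?_).le))) hle
    all_goals simp
  · refine le_iInf fun p => le_iInf fun q => le_iInf fun hc => ?_
    -- The default `0` is harmless: labels of vertices other than cut-vertices enter neither
    -- consistency nor cost.
    let x : V → ℕ := fun v => if h : IsCutVertex G v then p (ord.symm (.inl ⟨v, h⟩)) else 0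
    let a : V → ℕ := fun v => if h : IsCutVertex G v then q (ord.symm (.inl ⟨v, h⟩)) else 0
    have hx : ∀ v, p (ord.symm (.inl v)) = x v.1 := fun v => by simp [x, v.2]
    have ha : ∀ v, q (ord.symm (.inl v)) = a v.1 := fun v => by simp [a, v.2]
    rw [consistent_iff_labels hx (fun _ => rfl) ha fun _ => rfl] at hc
    rw [totalCost_eq_labelCost hx (fun _ => rfl) ha fun _ => rfl]
    by_cases htop : labelCost (BlockMem G) (IsCutVertex G) x a (fun B => p (ord.symm (.inr B)))
      (fun B => q (ord.symm (.inr B))) = ⊤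
    · rw [htop]; exact le_top
    obtain ⟨f, hf, hcost⟩ := hcover.exists_of_labels hc htop
    rw [← hcost]
    exact Nat.cast_le.2 (Nat.sInf_le ⟨f, hf, rfl⟩)

end BlockCutTree

/-! ### Assembly and the case of a single block -/

lemma blockCutGraph_adj_kindCode {V : Type*} [Fintype V] {G : SimpleGraph V} {v w : BCVertex G}
    (h : (blockCutGraph G).Adj v w) : kindCode G v = 3 ↔ ¬ kindCode G w = 3 := by
  rcases v with v | B <;> rcases w with w | D
  · exact absurd h (by simp [blockCutGraph])
  · simpa [kindCode] using kindCode_inr_ne D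
  · simpa [kindCode] using kindCode_inr_ne B
  · exact absurd h (by simp [blockCutGraph])

lemma exec_algorithm_of_size_eq_one {s : Memory} (h : s.reg .size = 1) :
    (algorithm.exec s).1.result = (if s.tab .kind 0 = 1 then 1 else 2) ∧
      (algorithm.exec s).2 ≤ 200 := by
  unfold algorithm
  rw [exec_ifEq_pos (show (IExp.reg .size).eval s = (IExp.lit 1).eval s from h)]
  by_cases hk : s.tab .kind 0 = 1
  · rw [exec_ifEq_pos (show (IExp.tab .kind (.lit 0)).eval s = (IExp.lit 1).eval s from hk),
      if_pos hk]
    simp [Prog.exec, NExp.eval, IExp.cost, NExp.cost]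
  · rw [exec_ifEq_neg (show (IExp.tab .kind (.lit 0)).eval s ≠ (IExp.lit 1).eval s from hk),
      if_neg hk]
    simp [Prog.exec, NExp.eval, IExp.cost, NExp.cost]

end ItalianBlock

theorem mainTheorem1 :
    ∃ C : ℕ, ∀ (V : Type*) [Fintype V] (G : SimpleGraph V),
      G.Connected → ItalianBlock.IsBlockGraph G →
      ∀ (n : ℕ) (ord : Fin n ≃ ItalianBlock.BCVertex G),
        ItalianBlock.IsTreeOrder (ItalianBlock.blockCutGraph G) ord →
        ∀ s : ItalianBlock.Memory, ItalianBlock.HoldsInput G ord s →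
          (ItalianBlock.algorithm.exec s).1.result = (ItalianBlock.indepItalianNumber G : ℕ∞) ∧
          (ItalianBlock.algorithm.exec s).2 ≤
            C * (n + (ItalianBlock.blockCutGraph G).edgeSet.ncard) := by
  open ItalianBlock in
  -- Each vertex costs at most `41` steps of initialization and `101` of elimination; `200` also
  -- absorbs the overhead.
  refine ⟨200, fun V _ G hconn hG n ord hT s ⟨hsize, hkind, hpar⟩ => ?_⟩
  have hadj := fun i k => blockCutGraph_adj_kindCode (v := ord i) (w := ord k)
  rw [← minCost_eq_indepItalianNumber hG hT]
  obtain ⟨v⟩ := hconn.nonempty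
  obtain ⟨B, hvB⟩ := (cliqueCover_blocks hG hT).exists_mem v
  have hpos : 0 < n := (Nat.zero_le _).trans_lt (ord.symm (.inr B)).isLt
  rcases Nat.lt_or_ge 1 n with hn | hn
  · obtain ⟨h1, h2⟩ := exec_algorithm (A := fun i k => (blockCutGraph G).Adj (ord i) (ord k))
      (kind := fun i => kindCode G (ord i)) hn (fun _ _ h => h.symm) hadj hT hsize hkind hpar
    exact ⟨h1, h2.trans (Nat.mul_le_mul_left _ (Nat.le_add_right _ _))⟩
  obtain rfl : n = 1 := by omega
  obtain ⟨h1, h2⟩ := exec_algorithm_of_size_eq_one hsize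
  refine ⟨h1.trans ?_, h2.trans (by omega)⟩
  have hord : ord 0 = .inr B := by
    rw [← ord.apply_symm_apply (.inr B)]
    exact congrArg ord (Subsingleton.elim _ _)
  have hcut : ∀ u, ¬ IsCutVertex G u := fun u hu => by
    have := ord.symm.injective (Subsingleton.elim (ord.symm (.inl ⟨u, hu⟩)) (ord.symm (.inr B)))
    simp at this
  have hk0 : s.tab .kind 0 = kindCode G (.inr B) := by rw [← hord]; exact hkind 0
  -- Without cut-vertices, `v` is a private vertex of `B`, which excludes type `0`.
  have hne0 : kindCode G (.inr B) ≠ 0 := by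
    rw [kindCode_inr]
    have hcard := Finset.card_ne_zero_of_mem
      (mem_privateVertices.2 ⟨hvB, hcut v⟩ : v ∈ privateVertices (BlockMem G) (IsCutVertex G) B)
    unfold cliqueType
    rw [if_neg hcard]
    split_ifs <;> omega
  have hne3 := kindCode_inr_ne B
  symm
  rw [hk0]
  -- With a single block the root is reached at once, so the constants `1` and `2` are the minima of
  -- the initial tables of types `1` and `2`.
  have hlast : ∀ b0 b1 b2 b01 b02, initCost (kindCode G (.inr B)) = blockCost b0 b1 b2 b01 b02 →
      minCost (fun i k => (blockCutGraph G).Adj (ord i) (ord k))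
        (fun i => kindCode G (ord i) = 3) (fun i => initCost (kindCode G (ord i))) 0 =
        min (min b0 b1) b2 := fun b0 b1 b2 b01 b02 h =>
    minCost_last_block (t := 0) rfl (SimpleGraph.irrefl _) (by rw [hord]; exact hne3)
      (by rw [hord]; exact h)
  split_ifs with h
  · simpa using hlast ⊤ 1 ⊤ ⊤ 2 (by simp [initCost, h])
  · simpa using hlast ⊤ ⊤ 2 ⊤ 2 (by simp [initCost, h, hne0, hne3])
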